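/- **Theorem (robust generalization bound).** There is a universal constant $C>0$ such that the following holds. Let $d,m\ge 1$, let $h$ be a bound on the number of output units of each of the $d$ layers, let $n$ be the input dimension and $k\ge 2$ the number of classes, and let $B,\epsilon,\gamma,\delta>0$. For weights $\mathbf w=(W_1,\dots,W_d)$ let $f_{\mathbf w}(\mathbf x)=W_d\,\phi(W_{d-1}\,\phi(\cdots\phi(W_1\mathbf x)))\in\mathbb R^k$ be the $d$-layer feedforward network with ReLU activation $\phi$ and given layer sizes, and let $$\Phi(f_{\mathbf w})=\prod_{i=1}^d\|W_i\|_2^2\ \sum_{i=1}^d\frac{\|W_i\|_F^2}{\|W_i\|_2^2}$$ (spectral norms $\|\cdot\|_2$, Frobenius norms $\|\cdot\|_F$; $\Phi=0$ if some $W_i=0$). Let $\mathcal D$ be a probability distribution on pairs $(\mathbf x,y)\in\mathbb R^n\times\{1,\dots,k\}$. For $p\in[1,\infty]$ and $\gamma'\ge 0$ let $$R^{(p)}_{\gamma'}(f_{\mathbf w})=\mathbb P_{(\mathbf x,y)\sim\mathcal D}\Big[\exists\,\mathbf x':\ \|\mathbf x'-\mathbf x\|_p\le\epsilon,\ f_{\mathbf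 w}(\mathbf x')[y]\le\gamma'+\max_{j\ne y}f_{\mathbf w}(\mathbf x')[j]\Big],$$ and let $\hat R^{(p)}_{\gamma'}(f_{\mathbf w})$ be the fraction of the $m$ samples of an i.i.d. training set drawn from $\mathcal D$ for which this event occurs. (1) ($\ell_2$ attacks.) If $\|\mathbf x\|_2\le B$ almost surely, then with probability at least $1-\delta$ over the training set, for all $\mathbf w$ simultaneously, $$R^{(2)}_0(f_{\mathbf w})-\hat R^{(2)}_\gamma(f_{\mathbf w})\le C\sqrt{\frac{1}{m}\Big(\frac{(B+\epsilon)^2d^2h\ln(dh)\,\Phi(f_{\mathbf w})}{\gamma^2}+\ln\frac{dm}{\delta}\Big)} .$$ (2) ($\ell_p$ attacks.) Let $1\le p\le\infty$, and let $h$ also bound the input dimension, $n\le h$. If $\|\mathbf x\|_p\le B$ almost surely, then with probability at least $1-\delta$ over the training set, for all $\mathbf w$ simultaneously, the bound of (1) holds for $R^{(p)}_0(f_{\mathbf w})-\hat R^{(p)}_\gamma(f_{\mathbf w})$ with $B+\epsilon$ replaced by $\max\{1,n^{\frac12-\frac1p}\}(B+\epsilon)$. -/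

import Mathlib

open MeasureTheory
open scoped ENNReal Matrix

noncomputable section

namespace RobustNet

/-- Weights `(W_1, …, W_d)` of a `d`-layer feedforward network with `N 0` inputs in which layer `i`
has `N i` output units; with zero-based indices, `W i` maps the output of layer `i` to layer
`i + 1`. -/
abbrev Weights {d : ℕ} (N : Fin (d + 1) → ℕ) : Type :=
  ∀ i : Fin d, Matrix (Fin (N i.succ)) (Fin (N i.castSucc)) ℝ

/-- The ReLU activation, applied coordinatewise. -/
def relu {n : ℕ} (v : Fin n → ℝ) : Fin n → ℝ := fun a => max (v a) 0

/-- The output of each layer before activation: level `0` is the input `x`, level `1` is `W_1 x`,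
and level `i + 1` is `W_{i+1} relu (level i)` for `i ≥ 1`. -/
def layer {d : ℕ} {N : Fin (d + 1) → ℕ} (W : Weights N) (x : Fin (N 0) → ℝ) :
    ∀ i : Fin (d + 1), Fin (N i) → ℝ :=
  Fin.induction x (fun i v => W i *ᵥ (if (i : ℕ) = 0 then v else relu v))

/-- The network function `f_w`. -/
def net {d : ℕ} {N : Fin (d + 1) → ℕ} (W : Weights N) (x : Fin (N 0) → ℝ) :
    Fin (N (Fin.last d)) → ℝ :=
  layer W x (Fin.last d)

/-- The spectral norm: the operator norm with respect to the Euclidean norms. -/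
def specNorm {a b : ℕ} (A : Matrix (Fin a) (Fin b) ℝ) : ℝ :=
  @norm _ Matrix.instL2OpNormedAddCommGroup.toNorm A

/-- The Frobenius norm. -/
def frobNorm {a b : ℕ} (A : Matrix (Fin a) (Fin b) ℝ) : ℝ :=
  √(∑ i, ∑ j, A i j ^ 2)

/-- The spectral complexity `∏ ‖W_i‖₂² · ∑ ‖W_i‖_F² / ‖W_i‖₂²`. It is `0` if some `W_i` is `0`
(then the network function vanishes). -/
def spectralComplexity {d : ℕ} {N : Fin (d + 1) → ℕ} (W : Weights N) : ℝ :=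
  (∏ i, specNorm (W i) ^ 2) * ∑ i, frobNorm (W i) ^ 2 / specNorm (W i) ^ 2

/-- The `ℓ_p` norm on `ℝⁿ`. -/
def vecLpNorm (p : ℝ≥0∞) {n : ℕ} (x : Fin n → ℝ) : ℝ := ‖WithLp.toLp p x‖

/-- The factor `max {1, n^(1/2 - 1/p)}` (with `1/∞ = 0`). -/
def lpFactor (p : ℝ≥0∞) (n : ℕ) : ℝ :=
  max 1 ((n : ℝ) ^ ((1 / 2 : ℝ) - (1 / p).toReal))

/-- The labelled examples `(x, y)` for which some `x'` in the `ℓ_p` ball of radius `ε` around `x`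
satisfies `f(x')[y] ≤ γ + max_{j ≠ y} f(x')[j]`. -/
def robustErrorSet {n k : ℕ} (p : ℝ≥0∞) (ε γ : ℝ) (f : (Fin n → ℝ) → Fin k → ℝ) :
    Set ((Fin n → ℝ) × Fin k) :=
  {z | ∃ x' : Fin n → ℝ, vecLpNorm p (x' - z.1) ≤ ε ∧
    f x' z.2 ≤ γ + ⨆ j : {j : Fin k // j ≠ z.2}, f x' j}

/-- The expected robust margin loss `R_γ(f)`. -/
def robustLoss {n k : ℕ} (p : ℝ≥0∞) (ε γ : ℝ) (D : Measure ((Fin n → ℝ) × Fin k))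
    (f : (Fin n → ℝ) → Fin k → ℝ) : ℝ :=
  D.real (robustErrorSet p ε γ f)

/-- The empirical robust margin loss on the training set `S`: the fraction of the samples that lie
in the error set. -/
def empRobustLoss {n k m : ℕ} (p : ℝ≥0∞) (ε γ : ℝ) (S : Fin m → (Fin n → ℝ) × Fin k)
    (f : (Fin n → ℝ) → Fin k → ℝ) : ℝ :=
  (∑ i, (robustErrorSet p ε γ f).indicator (fun _ => (1 : ℝ)) (S i)) / m

end RobustNet

end

/-!
The bound is a PAC-Bayes bound with a Gaussian prior and Gaussian posteriors, based on the fact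
that a small perturbation of the weights moves the margin of a network only a little, uniformly
over all attacks.

*Dimension of the attacks.* Write an attacked input as `x + x'`. The first layer computes
`W₁ x + W₁ x'`, and the attack enters through `W₁ x'` alone. For Euclidean attacks, `W₁` can be
replaced in this second term by a matrix `M` with only `h` columns, since `W₁` has at most `h` rows
and its row space can be identified with a subspace of `ℝ^h` (`exists_matrix_image_ball_eq`). For
`ℓ_p` attacks the input dimension is at most `h` by assumption, `M = W₁` works, and the `ℓ_p` norms
are compared with the Euclidean norm (`vecLpNorm_two_le_lpFactor_mul`). The matrices `W` and `M`
are treated as independent parameters from there on.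

*Stability.* Gaussian noise on `M` and on `W₂, …, W_d` has spectral norm of order `√(h log (d h))`
by a union bound over nets (`gauss_specNorm_gt_le`). The first weight matrix may have arbitrarily
many columns, but only the image of the fixed clean input `x` under its noise matters, and this is
controlled without reference to the number of columns (`gauss_mulVec_gt_le`). With probability
`3/4` the noise therefore changes the margin by at most `γ / 4` for all attacks at once
(`abs_margin_sub_le`).

*Generalization.* Apply to the posterior probability of an adversarial error at margin `γ / 2` the
ramp that is `0` on `[0, 1/4]` and `1` on `[3/4, 1]`. By stability the result lies between the
indicators of an adversarial error at margin `0` and at margin `γ`. The exponential moment of the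
supremum over posteriors of the centred sum of these functions is bounded one sample at a time:
symmetrization and the contraction principle (`exp_iSup_contraction`) remove the ramp, and the
Donsker–Varadhan inequality for translated Gaussian measures (`exp_integral_gauss_translate_le`)
removes the supremum (`lintegral_exp_iSup_posterior_le`). Restricting the posteriors to a finite
net keeps every supremum finite and measurable; rounding the weights to the net is one more small
perturbation. This gives the bound at a fixed noise level (`measure_deviation_fixed_scale_le`).

*Choice of the noise level.* By positive homogeneity the weight matrices may be taken to have equal
spectral norms (`exists_balanced`); the Frobenius norms then turn into the spectral complexity.
If the product of the spectral norms is small, every sample counts as an error at margin `γ`, and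
if the complexity is large, the bound exceeds one. The remaining networks are covered by `3 m²`
classes, each with its own noise level (`exists_grid_class`), and a union bound over the classes
finishes the proof (`measure_not_robust_bound_le`).
-/

noncomputable section

namespace RobustNet

/-! ### The exponential moment of ramped posterior means -/

section ExpMoment

lemma le_iSup_of_finite {T : Type*} [Finite T] (a : T → ℝ) (t : T) : a t ≤ ⨆ t, a t :=
  le_ciSup (Set.finite_range a).bddAbove t

lemma exp_mul_sub_one_mono {x y p q : ℝ} (hyx : y ≤ x) (hp : 0 ≤ p) (hpq : p ≤ q) :
    Real.exp (y + p) - Real.exp y ≤ Real.exp (x + q) - Real.exp x := by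
  have h1 : Real.exp p ≤ Real.exp q := Real.exp_le_exp.2 hpq
  have h2 : Real.exp y ≤ Real.exp x := Real.exp_le_exp.2 hyx
  have h3 : 1 ≤ Real.exp p := Real.one_le_exp hp
  rw [Real.exp_add, Real.exp_add]
  nlinarith [Real.exp_pos y, Real.exp_pos x]

variable {T : Type*} [Finite T] [Nonempty T]

/-- The Ledoux–Talagrand contraction principle for one random sign and the convex function `exp`:
replacing the nonnegative numbers `b t` by their images `c t` under a monotone contraction fixing
`0` decreases the exponential moment of the supremum. -/
lemma exp_iSup_contraction (a b c : T → ℝ) (hc : ∀ t, 0 ≤ c t) (hcb : ∀ t, c t ≤ b t)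
    (hlip : ∀ s t, b s ≤ b t → c s ≤ c t ∧ c t - c s ≤ b t - b s) :
    Real.exp (⨆ t, (a t + c t)) + Real.exp (⨆ t, (a t - c t)) ≤
      Real.exp (⨆ t, (a t + b t)) + Real.exp (⨆ t, (a t - b t)) := by
  obtain ⟨s, hs⟩ := exists_eq_ciSup_of_finite (f := fun t => a t + c t)
  obtain ⟨t, ht⟩ := exists_eq_ciSup_of_finite (f := fun t => a t - c t)
  rw [← hs, ← ht]
  have key : ∀ p q : T, Real.exp (a p + b p) + Real.exp (a q - b q) ≤
      Real.exp (⨆ t, (a t + b t)) + Real.exp (⨆ t, (a t - b t)) := fun p q =>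
    add_le_add (Real.exp_le_exp.2 (le_iSup_of_finite (fun t => a t + b t) p))
      (Real.exp_le_exp.2 (le_iSup_of_finite (fun t => a t - b t) q))
  have hcs := hc s
  have hct := hc t
  have hbs := hcb s
  have hbt := hcb t
  -- In the first case the maximisers keep their roles unless the second term dominates,
  -- in the second case they are exchanged unless the first term dominates.
  rcases le_total (b t) (b s) with hle | hle
  · have hl := hlip t s hle
    by_cases hcase : a t - b t ≤ a s + c s
    · refine le_trans ?_ (key s t)
      have := exp_mul_sub_one_mono hcase (p := b t - c t) (q := b s - c s) (by linarith)
        (by linarith)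
      rw [show a t - b t + (b t - c t) = a t - c t by ring,
        show a s + c s + (b s - c s) = a s + b s by ring] at this
      linarith
    · refine le_trans ?_ (key t t)
      push Not at hcase
      have h1 : Real.exp (a s + c s) ≤ Real.exp (a t - b t) := Real.exp_le_exp.2 hcase.le
      have h2 : Real.exp (a t - c t) ≤ Real.exp (a t + b t) := Real.exp_le_exp.2 (by linarith)
      linarith
  · have hl := hlip s t hle
    by_cases hcase : a s - b s ≤ a t - c t
    · refine le_trans ?_ (key t s)
      have := exp_mul_sub_one_mono hcase (p := b s + c s) (q := b t + c t) (by linarith)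
        (by linarith)
      rw [show a s - b s + (b s + c s) = a s + c s by ring,
        show a t - c t + (b t + c t) = a t + b t by ring] at this
      linarith
    · refine le_trans ?_ (key s s)
      push Not at hcase
      have h1 : Real.exp (a t - c t) ≤ Real.exp (a s - b s) := Real.exp_le_exp.2 hcase.le
      have h2 : Real.exp (a s + c s) ≤ Real.exp (a s + b s) := Real.exp_le_exp.2 (by linarith)
      linarith

/-- The ramp `ℝ → [0, 1]` that vanishes up to `1/4`, equals `1` from `3/4` on, and is linear in
between. Composed with the probability of an error under a random perturbation of the weights it
gives a Lipschitz substitute for the majority vote. -/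
def ramp (x : ℝ) : ℝ := max 0 (min 1 (2 * x - 1 / 2))

lemma ramp_nonneg (x : ℝ) : 0 ≤ ramp x := le_max_left _ _

lemma ramp_le_one (x : ℝ) : ramp x ≤ 1 := max_le zero_le_one (min_le_left _ _)

lemma ramp_le_two_mul {x : ℝ} (hx : 0 ≤ x) : ramp x ≤ 2 * x :=
  max_le (by linarith) ((min_le_right _ _).trans (by linarith))

lemma ramp_mono_lipschitz {x y : ℝ} (h : x ≤ y) :
    ramp x ≤ ramp y ∧ ramp y - ramp x ≤ 2 * (y - x) := by
  unfold ramp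
  grind

lemma ramp_eq_zero {x : ℝ} (hx : x ≤ 1 / 4) : ramp x = 0 :=
  max_eq_left ((min_le_right _ _).trans (by linarith))

lemma ramp_eq_one {x : ℝ} (hx : 3 / 4 ≤ x) : ramp x = 1 := by
  unfold ramp
  grind

lemma continuous_ramp : Continuous ramp := by
  unfold ramp; fun_prop

/-- Symmetrization for a single sample point, combined with the contraction principle: the centred
empirical term of the ramped functions `ramp (g t x)` is dominated by a random sign times
`4 * g t x`. -/
lemma lintegral_exp_iSup_le_symmetrized {X : Type*} [MeasurableSpace X] (D : Measure X)
    [IsProbabilityMeasure D] (g : T → X → ℝ) (hg : ∀ t, Measurable (g t))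
    (hg0 : ∀ t x, 0 ≤ g t x) (l : ℝ) (hl : 0 ≤ l) (a : T → ℝ) :
    ∫⁻ x, ENNReal.ofReal (Real.exp (⨆ t, (a t + l * (∫ y, ramp (g t y) ∂D - ramp (g t x))))) ∂D ≤
      ∫⁻ x, (2⁻¹ * ENNReal.ofReal (Real.exp (⨆ t, (a t + 4 * l * g t x))) +
        2⁻¹ * ENNReal.ofReal (Real.exp (⨆ t, (a t - 4 * l * g t x)))) ∂D := by
  set E : T → ℝ := fun t => ∫ y, ramp (g t y) ∂D with hE
  have hrm : ∀ t, Measurable fun x => ramp (g t x) := fun t => continuous_ramp.measurable.comp (hg t)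
  have hsupm : ∀ c : ℝ, Measurable fun x => Real.exp (⨆ t, (a t + c * ramp (g t x))) := fun c =>
    Real.measurable_exp.comp (Measurable.iSup fun t => ((hrm t).const_mul c).const_add (a t))
  have hsup : ∀ x, ⨆ t, (a t + 2 * l * ramp (g t x)) ≤ (⨆ t, a t) + 2 * l := fun x =>
    ciSup_le fun t => add_le_add (le_iSup_of_finite a t)
      (by nlinarith [ramp_le_one (g t x), ramp_nonneg (g t x)])
  have hint : Integrable (fun x => Real.exp (⨆ t, (a t + 2 * l * ramp (g t x)))) D := by
    refine Integrable.of_bound (hsupm _).aestronglyMeasurable (Real.exp ((⨆ t, a t) + 2 * l))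
      (Filter.Eventually.of_forall fun x => ?_)
    rw [Real.norm_of_nonneg (Real.exp_pos _).le]
    exact Real.exp_le_exp.2 (hsup x)
  have hrint : ∀ t, Integrable (fun x => ramp (g t x)) D := fun t => by
    refine Integrable.of_bound (hrm t).aestronglyMeasurable 1
      (Filter.Eventually.of_forall fun x => ?_)
    rw [Real.norm_of_nonneg (ramp_nonneg _)]
    exact ramp_le_one _
  -- Jensen's inequality for the centring term
  have hjensen : Real.exp (⨆ t, (a t + 2 * l * E t)) ≤
      ∫ x, Real.exp (⨆ t, (a t + 2 * l * ramp (g t x))) ∂D := by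
    obtain ⟨t, ht⟩ := exists_eq_ciSup_of_finite (f := fun t => a t + 2 * l * E t)
    rw [← ht]
    have h1 : a t + 2 * l * E t = ∫ x, (a t + 2 * l * ramp (g t x)) ∂D := by
      rw [integral_add (integrable_const _) ((hrint t).const_mul _), integral_const_mul]
      simp [hE]
    have hint' : Integrable (fun x => Real.exp (a t + 2 * l * ramp (g t x))) D := by
      refine hint.mono' (Real.measurable_exp.comp
        (((hrm t).const_mul _).const_add _)).aestronglyMeasurable
        (Filter.Eventually.of_forall fun x => ?_)
      rw [Real.norm_of_nonneg (Real.exp_pos _).le]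
      exact Real.exp_le_exp.2 (le_iSup_of_finite (fun t => a t + 2 * l * ramp (g t x)) t)
    calc Real.exp (a t + 2 * l * E t) = Real.exp (∫ x, (a t + 2 * l * ramp (g t x)) ∂D) := by
          rw [h1]
      _ ≤ ∫ x, Real.exp (a t + 2 * l * ramp (g t x)) ∂D :=
          convexOn_exp.map_integral_le Real.continuous_exp.continuousOn isClosed_univ
            (Filter.Eventually.of_forall fun _ => Set.mem_univ _)
            ((integrable_const _).add ((hrint t).const_mul _)) hint'
      _ ≤ _ := integral_mono hint' hint fun x =>
          Real.exp_le_exp.2 (le_iSup_of_finite (fun t => a t + 2 * l * ramp (g t x)) t)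
  have hjensen' : ENNReal.ofReal (Real.exp (⨆ t, (a t + 2 * l * E t))) ≤
      ∫⁻ x, ENNReal.ofReal (Real.exp (⨆ t, (a t + 2 * l * ramp (g t x)))) ∂D := by
    rw [← ofReal_integral_eq_lintegral_ofReal hint
      (Filter.Eventually.of_forall fun x => (Real.exp_pos _).le)]
    exact ENNReal.ofReal_le_ofReal hjensen
  have half : ∀ x y : ℝ, 0 ≤ x → 0 ≤ y → ENNReal.ofReal ((x + y) / 2) =
      2⁻¹ * ENNReal.ofReal x + 2⁻¹ * ENNReal.ofReal y := fun x y hx hy => by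
    rw [← mul_add, ← ENNReal.ofReal_add hx hy, mul_comm, div_eq_mul_inv,
      ENNReal.ofReal_mul (by positivity), ENNReal.ofReal_inv_of_pos two_pos]
    simp
  have hm : Measurable fun x => ENNReal.ofReal (Real.exp (⨆ t, (a t + 2 * l * ramp (g t x)))) :=
    ENNReal.measurable_ofReal.comp (hsupm _)
  calc ∫⁻ x, ENNReal.ofReal (Real.exp (⨆ t, (a t + l * (E t - ramp (g t x))))) ∂D
      ≤ ∫⁻ x, (2⁻¹ * ENNReal.ofReal (Real.exp (⨆ t, (a t + 2 * l * E t))) +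
          2⁻¹ * ENNReal.ofReal (Real.exp (⨆ t, (a t - 2 * l * ramp (g t x))))) ∂D := by
        refine lintegral_mono fun x => ?_
        rw [← half _ _ (Real.exp_pos _).le (Real.exp_pos _).le]
        refine ENNReal.ofReal_le_ofReal ?_
        have h1 : ⨆ t, (a t + l * (E t - ramp (g t x))) ≤
            ((⨆ t, (a t + 2 * l * E t)) + ⨆ t, (a t - 2 * l * ramp (g t x))) / 2 := by
          refine ciSup_le fun t => ?_
          have h2 := le_iSup_of_finite (fun t => a t + 2 * l * E t) t
          have h3 := le_iSup_of_finite (fun t => a t - 2 * l * ramp (g t x)) t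
          linarith
        refine (Real.exp_le_exp.2 h1).trans ?_
        set p := ⨆ t, (a t + 2 * l * E t)
        set q := ⨆ t, (a t - 2 * l * ramp (g t x))
        have hp : Real.exp p = Real.exp (p / 2) ^ 2 := by
          rw [← Real.exp_nat_mul]; congr 1; push_cast; ring
        have hq : Real.exp q = Real.exp (q / 2) ^ 2 := by
          rw [← Real.exp_nat_mul]; congr 1; push_cast; ring
        rw [add_div, Real.exp_add, hp, hq]
        nlinarith [sq_nonneg (Real.exp (p / 2) - Real.exp (q / 2))]
    _ = 2⁻¹ * ENNReal.ofReal (Real.exp (⨆ t, (a t + 2 * l * E t))) +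
          ∫⁻ x, 2⁻¹ * ENNReal.ofReal (Real.exp (⨆ t, (a t - 2 * l * ramp (g t x)))) ∂D := by
        rw [lintegral_add_left measurable_const]
        simp
    _ ≤ 2⁻¹ * (∫⁻ x, ENNReal.ofReal (Real.exp (⨆ t, (a t + 2 * l * ramp (g t x)))) ∂D) +
          ∫⁻ x, 2⁻¹ * ENNReal.ofReal (Real.exp (⨆ t, (a t - 2 * l * ramp (g t x)))) ∂D := by
        gcongr
    _ = ∫⁻ x, (2⁻¹ * ENNReal.ofReal (Real.exp (⨆ t, (a t + 2 * l * ramp (g t x)))) +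
          2⁻¹ * ENNReal.ofReal (Real.exp (⨆ t, (a t - 2 * l * ramp (g t x))))) ∂D := by
        rw [← lintegral_const_mul _ hm, ← lintegral_add_left (hm.const_mul _)]
    _ ≤ _ := by
        refine lintegral_mono fun x => ?_
        rw [← half _ _ (Real.exp_pos _).le (Real.exp_pos _).le,
          ← half _ _ (Real.exp_pos _).le (Real.exp_pos _).le]
        refine ENNReal.ofReal_le_ofReal ?_
        have := exp_iSup_contraction a (fun t => 4 * l * g t x)
          (fun t => 2 * l * ramp (g t x)) (fun t => by have := ramp_nonneg (g t x); positivity)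
          (fun t => by have := ramp_le_two_mul (hg0 t x); nlinarith) (fun s t hst => by
            rcases hl.eq_or_lt with rfl | hl'
            · simp
            · have h := ramp_mono_lipschitz (le_of_mul_le_mul_left hst (by positivity : 0 < 4 * l))
              constructor <;> nlinarith [h.1, h.2])
        linarith

lemma lintegral_half_add_half {α : Type*} [MeasurableSpace α] {μ : Measure α} {F G : α → ℝ≥0∞}
    (hF : Measurable F) (hG : Measurable G) :
    ∫⁻ x, (2⁻¹ * F x + 2⁻¹ * G x) ∂μ = 2⁻¹ * ∫⁻ x, F x ∂μ + 2⁻¹ * ∫⁻ x, G x ∂μ := by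
  rw [lintegral_add_left (hF.const_mul _), lintegral_const_mul _ hF, lintegral_const_mul _ hG]

lemma lintegral_lintegral_half_add_half {α β : Type*} [MeasurableSpace α] [MeasurableSpace β]
    {μ : Measure α} {ν : Measure β} [SFinite ν] {F G : α → β → ℝ≥0∞}
    (hF : Measurable (Function.uncurry F)) (hG : Measurable (Function.uncurry G)) :
    ∫⁻ x, ∫⁻ y, (2⁻¹ * F x y + 2⁻¹ * G x y) ∂ν ∂μ =
      2⁻¹ * ∫⁻ x, ∫⁻ y, F x y ∂ν ∂μ + 2⁻¹ * ∫⁻ x, ∫⁻ y, G x y ∂ν ∂μ := by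
  rw [← lintegral_half_add_half hF.lintegral_prod_right hG.lintegral_prod_right]
  exact lintegral_congr fun x => lintegral_half_add_half
    (hF.comp measurable_prodMk_left) (hG.comp measurable_prodMk_left)

/-- The exponential moment bound behind the PAC-Bayes inequality. The posteriors `Q t` are all
within `K` of the prior `P`, in the sense of the Donsker–Varadhan inequality `hQ`. The function `b`
collects the terms of the sample points that have already been symmetrized, which makes the
induction on the number of sample points work. -/
lemma lintegral_exp_iSup_posterior_le {X U : Type*} [MeasurableSpace X] [MeasurableSpace U]
    (D : Measure X) [IsProbabilityMeasure D] (P : Measure U) [SFinite P] (Q : T → Measure U)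
    [∀ t, IsProbabilityMeasure (Q t)] (K : ℝ)
    (hQ : ∀ t, ∀ b : U → ℝ, Measurable b → (∃ c, ∀ u, |b u| ≤ c) →
      ENNReal.ofReal (Real.exp (∫ u, b u ∂(Q t))) ≤
        ENNReal.ofReal (Real.exp K) * ∫⁻ u, ENNReal.ofReal (Real.exp (b u)) ∂P)
    (e : U → X → ℝ) (he : Measurable (Function.uncurry e)) (he0 : ∀ u x, 0 ≤ e u x)
    (he1 : ∀ u x, e u x ≤ 1) (l : ℝ) (hl : 0 ≤ l) (m : ℕ) :
    ∀ b : U → ℝ, Measurable b → (∃ c, ∀ u, |b u| ≤ c) →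
      ∫⁻ S : Fin m → X, ENNReal.ofReal (Real.exp (⨆ t, (∫ u, b u ∂(Q t) +
          ∑ i, l * (∫ y, ramp (∫ u, e u y ∂(Q t)) ∂D - ramp (∫ u, e u (S i) ∂(Q t))))))
          ∂(Measure.pi fun _ => D) ≤
        ENNReal.ofReal (Real.exp (8 * l ^ 2 * m + K)) *
          ∫⁻ u, ENNReal.ofReal (Real.exp (b u)) ∂P := by
  have hgm : ∀ t, Measurable fun x => ∫ u, e u x ∂(Q t) := fun t => by
    have : StronglyMeasurable (Function.uncurry fun x u => e u x) :=
      (he.comp measurable_swap).stronglyMeasurable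
    exact (this.integral_prod_right (ν := Q t)).measurable
  have hg0 : ∀ t x, 0 ≤ ∫ u, e u x ∂(Q t) := fun t x => integral_nonneg fun u => he0 u x
  have hrm : ∀ t, Measurable fun x => ramp (∫ u, e u x ∂(Q t)) := fun t =>
    continuous_ramp.measurable.comp (hgm t)
  induction m with
  | zero =>
    intro b hb hbc
    simp only [Finset.univ_eq_empty, Finset.sum_empty, add_zero, lintegral_const, measure_univ,
      mul_one, Nat.cast_zero, mul_zero, zero_add]
    obtain ⟨t, ht⟩ := exists_eq_ciSup_of_finite (f := fun t => ∫ u, b u ∂(Q t))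
    rw [← ht]
    exact hQ t b hb hbc
  | succ m ih =>
    intro b hb hbc
    obtain ⟨c, hc⟩ := hbc
    have hbi : ∀ t, Integrable b (Q t) := fun t =>
      Integrable.of_bound hb.aestronglyMeasurable c (Filter.Eventually.of_forall hc)
    have hei : ∀ t x, Integrable (fun u => e u x) (Q t) := fun t x =>
      Integrable.of_bound (he.comp measurable_prodMk_right).aestronglyMeasurable 1
        (Filter.Eventually.of_forall fun u => by
          rw [Real.norm_of_nonneg (he0 u x)]; exact he1 u x)
    set g : T → X → ℝ := fun t x => ∫ u, e u x ∂(Q t) with hg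
    set A : T → (Fin m → X) → ℝ := fun t S =>
      ∑ i, l * (∫ y, ramp (g t y) ∂D - ramp (g t (S i))) with hA
    have hAm : ∀ t, Measurable (A t) := fun t => by
      refine Finset.measurable_sum _ fun i _ => ?_
      exact ((measurable_const.sub ((hrm t).comp (measurable_pi_apply i))).const_mul l)
    -- the function obtained after symmetrizing the new sample point `x` with sign `r`
    have hmeas : ∀ r : ℝ, Measurable fun p : (Fin m → X) × X => ENNReal.ofReal
        (Real.exp (⨆ t, (∫ u, b u ∂(Q t) + A t p.1 + r * g t p.2))) := fun r =>
      ENNReal.measurable_ofReal.comp (Real.measurable_exp.comp (Measurable.iSup fun t =>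
        (((hAm t).comp measurable_fst).const_add _).add (((hgm t).comp measurable_snd).const_mul r)))
    have hstep : ∀ r : ℝ, ∫⁻ S, ∫⁻ x, ENNReal.ofReal
        (Real.exp (⨆ t, (∫ u, b u ∂(Q t) + A t S + r * g t x))) ∂D ∂(Measure.pi fun _ => D) ≤
        ∫⁻ x, ENNReal.ofReal (Real.exp (8 * l ^ 2 * m + K)) *
          ∫⁻ u, ENNReal.ofReal (Real.exp (b u + r * e u x)) ∂P ∂D := fun r => by
      rw [lintegral_lintegral_swap (hmeas r).aemeasurable]
      refine lintegral_mono fun x => ?_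
      refine le_trans (le_of_eq ?_) (ih (fun u => b u + r * e u x)
        (hb.add ((he.comp measurable_prodMk_right).const_mul r)) ⟨c + |r|, fun u => ?_⟩)
      · refine lintegral_congr fun S => ?_
        congr 4 with t
        rw [integral_add (hbi t) ((hei t x).const_mul r), integral_const_mul]
        simp only [hA, hg]
        ring
      · refine (abs_add_le _ _).trans (add_le_add (hc u) ?_)
        rw [abs_mul, abs_of_nonneg (he0 u x)]
        exact mul_le_of_le_one_right (abs_nonneg r) (he1 u x)
    have hexpm : ∀ r : ℝ, Measurable fun p : X × U => ENNReal.ofReal (Real.exp (b p.2 + r * e p.2 p.1)) :=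
      fun r => ENNReal.measurable_ofReal.comp (Real.measurable_exp.comp
        ((hb.comp measurable_snd).add ((he.comp measurable_swap).const_mul r)))
    have hexpm' : ∀ r : ℝ, ∀ x, Measurable fun u => ENNReal.ofReal (Real.exp (b u + r * e u x)) :=
      fun r x => (hexpm r).comp measurable_prodMk_left
    calc _ = ∫⁻ p : X × (Fin m → X), ENNReal.ofReal (Real.exp (⨆ t, (∫ u, b u ∂(Q t) +
            A t p.2 + l * (∫ y, ramp (g t y) ∂D - ramp (g t p.1)))))
            ∂(D.prod (Measure.pi fun _ => D)) := by
          rw [← ((measurePreserving_piFinSuccAbove (fun _ : Fin (m + 1) => D) 0).symm).lintegral_comp_emb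
            (MeasurableEquiv.measurableEmbedding _)]
          refine lintegral_congr fun p => ?_
          congr 4 with t
          rw [Fin.sum_univ_succ]
          simp only [hA, MeasurableEquiv.piFinSuccAbove_symm_apply, Fin.insertNthEquiv_apply,
            Fin.insertNth_zero', Fin.cons_zero, Fin.cons_succ]
          ring
      _ = ∫⁻ S, ∫⁻ x, ENNReal.ofReal (Real.exp (⨆ t, (∫ u, b u ∂(Q t) +
            A t S + l * (∫ y, ramp (g t y) ∂D - ramp (g t x))))) ∂D ∂(Measure.pi fun _ => D) := by
          refine lintegral_prod_symm _ (Measurable.aemeasurable ?_)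
          exact ENNReal.measurable_ofReal.comp (Real.measurable_exp.comp (Measurable.iSup fun t =>
            (((hAm t).comp measurable_snd).const_add _).add
              ((measurable_const.sub ((hrm t).comp measurable_fst)).const_mul l)))
      _ ≤ ∫⁻ S, ∫⁻ x, (2⁻¹ * ENNReal.ofReal (Real.exp (⨆ t, (∫ u, b u ∂(Q t) + A t S +
              4 * l * g t x))) + 2⁻¹ * ENNReal.ofReal (Real.exp (⨆ t, (∫ u, b u ∂(Q t) + A t S +
              (-(4 * l)) * g t x)))) ∂D ∂(Measure.pi fun _ => D) := by
          refine lintegral_mono fun S => ?_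
          refine (lintegral_exp_iSup_le_symmetrized D g hgm hg0 l hl
            (fun t => ∫ u, b u ∂(Q t) + A t S)).trans (le_of_eq ?_)
          simp only [neg_mul, ← sub_eq_add_neg]
      _ = 2⁻¹ * (∫⁻ S, ∫⁻ x, ENNReal.ofReal (Real.exp (⨆ t, (∫ u, b u ∂(Q t) + A t S +
              4 * l * g t x))) ∂D ∂(Measure.pi fun _ => D)) +
            2⁻¹ * (∫⁻ S, ∫⁻ x, ENNReal.ofReal (Real.exp (⨆ t, (∫ u, b u ∂(Q t) + A t S +
              (-(4 * l)) * g t x))) ∂D ∂(Measure.pi fun _ => D)) := by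
          exact lintegral_lintegral_half_add_half
            (F := fun S x => ENNReal.ofReal (Real.exp (⨆ t, (∫ u, b u ∂(Q t) + A t S +
              4 * l * g t x))))
            (G := fun S x => ENNReal.ofReal (Real.exp (⨆ t, (∫ u, b u ∂(Q t) + A t S +
              (-(4 * l)) * g t x)))) (hmeas (4 * l)) (hmeas (-(4 * l)))
      _ ≤ 2⁻¹ * (∫⁻ x, ENNReal.ofReal (Real.exp (8 * l ^ 2 * m + K)) *
              ∫⁻ u, ENNReal.ofReal (Real.exp (b u + 4 * l * e u x)) ∂P ∂D) +
            2⁻¹ * (∫⁻ x, ENNReal.ofReal (Real.exp (8 * l ^ 2 * m + K)) *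
              ∫⁻ u, ENNReal.ofReal (Real.exp (b u + (-(4 * l)) * e u x)) ∂P ∂D) := by
          gcongr
          · exact hstep _
          · exact hstep _
      _ = ∫⁻ x, ENNReal.ofReal (Real.exp (8 * l ^ 2 * m + K)) * ∫⁻ u,
            (2⁻¹ * ENNReal.ofReal (Real.exp (b u + 4 * l * e u x)) +
            2⁻¹ * ENNReal.ofReal (Real.exp (b u + (-(4 * l)) * e u x))) ∂P ∂D := by
          have h1 : ∀ r : ℝ, Measurable fun x => ENNReal.ofReal (Real.exp (8 * l ^ 2 * m + K)) *
              ∫⁻ u, ENNReal.ofReal (Real.exp (b u + r * e u x)) ∂P := fun r =>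
            ((hexpm r).lintegral_prod_right' (ν := P)).const_mul _
          refine (lintegral_half_add_half (h1 _) (h1 _)).symm.trans (lintegral_congr fun x => ?_)
          rw [lintegral_half_add_half (hexpm' _ x) (hexpm' _ x)]
          ring
      _ ≤ ∫⁻ x, ENNReal.ofReal (Real.exp (8 * l ^ 2 * m + K)) * ∫⁻ u,
            ENNReal.ofReal (Real.exp (8 * l ^ 2)) * ENNReal.ofReal (Real.exp (b u)) ∂P ∂D := by
          gcongr with x u
          rw [← ENNReal.ofReal_mul (Real.exp_pos _).le]
          have h2 : (2⁻¹ : ℝ≥0∞) = ENNReal.ofReal 2⁻¹ := by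
            rw [ENNReal.ofReal_inv_of_pos two_pos]; simp
          rw [h2, ← ENNReal.ofReal_mul (by positivity), ← ENNReal.ofReal_mul (by positivity),
            ← ENNReal.ofReal_add (by positivity) (by positivity)]
          refine ENNReal.ofReal_le_ofReal ?_
          have hcosh := Real.cosh_le_exp_half_sq (4 * l * e u x)
          rw [Real.cosh_eq] at hcosh
          have h3 : Real.exp ((4 * l * e u x) ^ 2 / 2) ≤ Real.exp (8 * l ^ 2) := by
            refine Real.exp_le_exp.2 ?_
            have : e u x ^ 2 ≤ 1 := pow_le_one₀ (he0 u x) (he1 u x)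
            nlinarith [sq_nonneg l]
          rw [Real.exp_add, Real.exp_add, neg_mul]
          nlinarith [Real.exp_pos (b u)]
      _ = _ := by
          have hbm : Measurable fun u => ENNReal.ofReal (Real.exp (b u)) :=
            ENNReal.measurable_ofReal.comp (Real.measurable_exp.comp hb)
          rw [lintegral_const, measure_univ, mul_one, lintegral_const_mul _ hbm, ← mul_assoc,
            ← ENNReal.ofReal_mul (Real.exp_pos _).le, ← Real.exp_add]
          congr 3
          push_cast
          ring

end ExpMoment

/-! ### Deviation inequality and Gaussian measures -/

/-- The PAC-Bayes deviation inequality for ramped posterior means, uniform over a finite family of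
posteriors: Markov's inequality applied to the exponential moment with the optimal parameter. -/
lemma measure_exists_deviation_le {T : Type*} [Finite T] {X U : Type*} [MeasurableSpace X]
    [MeasurableSpace U]
    (D : Measure X) [IsProbabilityMeasure D] (P : Measure U) [IsProbabilityMeasure P]
    (Q : T → Measure U) [∀ t, IsProbabilityMeasure (Q t)] (K : ℝ)
    (hQ : ∀ t, ∀ b : U → ℝ, Measurable b → (∃ c, ∀ u, |b u| ≤ c) →
      ENNReal.ofReal (Real.exp (∫ u, b u ∂(Q t))) ≤
        ENNReal.ofReal (Real.exp K) * ∫⁻ u, ENNReal.ofReal (Real.exp (b u)) ∂P)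
    (e : U → X → ℝ) (he : Measurable (Function.uncurry e)) (he0 : ∀ u x, 0 ≤ e u x)
    (he1 : ∀ u x, e u x ≤ 1) (m : ℕ) (hm : 1 ≤ m) (L : ℝ) (hKL : 0 < K + L) :
    Measure.pi (fun _ : Fin m => D)
      {S | ∃ t, √(32 * m * (K + L)) < ∑ i, (∫ y, ramp (∫ u, e u y ∂(Q t)) ∂D -
        ramp (∫ u, e u (S i) ∂(Q t)))} ≤ ENNReal.ofReal (Real.exp (-L)) := by
  rcases isEmpty_or_nonempty T with hT | hT
  · simp
  have hm' : (0 : ℝ) < m := by exact_mod_cast hm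
  set V := K + L with hV
  set l := √(V / (8 * m)) with hl
  have hl0 : 0 < l := Real.sqrt_pos.2 (by positivity)
  have hl2 : 8 * l ^ 2 * m = V := by
    rw [hl, Real.sq_sqrt (by positivity)]; field_simp
  have hls : l * √(32 * m * V) = 2 * V := by
    rw [hl, ← Real.sqrt_mul (by positivity),
      show V / (8 * m) * (32 * m * V) = (2 * V) ^ 2 by field_simp; ring,
      Real.sqrt_sq (by positivity)]
  set A : T → (Fin m → X) → ℝ := fun t S => ∑ i, (∫ y, ramp (∫ u, e u y ∂(Q t)) ∂D -
        ramp (∫ u, e u (S i) ∂(Q t))) with hA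
  have hgm : ∀ t, Measurable fun x => ∫ u, e u x ∂(Q t) := fun t => by
    have : StronglyMeasurable (Function.uncurry fun x u => e u x) :=
      (he.comp measurable_swap).stronglyMeasurable
    exact (this.integral_prod_right (ν := Q t)).measurable
  have hAm : ∀ t, Measurable (A t) := fun t => Finset.measurable_sum _ fun i _ =>
    measurable_const.sub (continuous_ramp.measurable.comp ((hgm t).comp (measurable_pi_apply i)))
  have hmain := lintegral_exp_iSup_posterior_le D P Q K hQ e he he0 he1 l hl0.le m (fun _ => 0)
    measurable_const ⟨0, by simp⟩
  simp only [integral_zero, zero_add, Real.exp_zero, ENNReal.ofReal_one, lintegral_const,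
    measure_univ, mul_one, hl2, ← Finset.mul_sum] at hmain
  have hmeas : Measurable fun S => ENNReal.ofReal (Real.exp (⨆ t, l * A t S)) :=
    ENNReal.measurable_ofReal.comp (Real.measurable_exp.comp
      (Measurable.iSup fun t => (hAm t).const_mul l))
  have hmarkov := mul_meas_ge_le_lintegral (μ := Measure.pi fun _ : Fin m => D) hmeas
    (ENNReal.ofReal (Real.exp (2 * V)))
  have hsub : {S | ∃ t, √(32 * m * V) < A t S} ⊆
      {S | ENNReal.ofReal (Real.exp (2 * V)) ≤ ENNReal.ofReal (Real.exp (⨆ t, l * A t S))} := by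
    rintro S ⟨t, ht⟩
    refine ENNReal.ofReal_le_ofReal (Real.exp_le_exp.2 ?_)
    refine le_trans ?_ (le_iSup_of_finite (fun t => l * A t S) t)
    rw [← hls]
    exact mul_le_mul_of_nonneg_left ht.le hl0.le
  refine (measure_mono hsub).trans ?_
  have h1 := hmarkov.trans hmain
  have h2 : ENNReal.ofReal (Real.exp (V + K)) =
      ENNReal.ofReal (Real.exp (2 * V)) * ENNReal.ofReal (Real.exp (-L)) := by
    rw [← ENNReal.ofReal_mul (Real.exp_pos _).le, ← Real.exp_add]
    congr 2
    rw [hV]; ring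
  rw [h2] at h1
  exact (ENNReal.mul_le_mul_iff_right (by simp [Real.exp_pos]) ENNReal.ofReal_ne_top).1 h1

section Gaussian

variable {I : Type*} [Fintype I]

/-- The unnormalized density of the standard Gaussian distribution. -/
def gaussDensity (u : I → ℝ) : ℝ≥0∞ := ENNReal.ofReal (Real.exp (-(u ⬝ᵥ u) / 2))

variable (I) in
/-- The standard Gaussian distribution on `ℝ^I`, normalized from its density with respect to
Lebesgue measure. -/
def gauss : Measure (I → ℝ) :=
  (∫⁻ u : I → ℝ, gaussDensity u)⁻¹ • volume.withDensity gaussDensity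

lemma measurable_dotProduct_self : Measurable fun u : I → ℝ => u ⬝ᵥ u := by
  unfold dotProduct; fun_prop

lemma measurable_dotProduct_left (c : I → ℝ) : Measurable fun u : I → ℝ => c ⬝ᵥ u := by
  unfold dotProduct; fun_prop

lemma measurable_gaussDensity : Measurable (gaussDensity (I := I)) :=
  ENNReal.measurable_ofReal.comp
    (Real.measurable_exp.comp (measurable_dotProduct_self.neg.div_const 2))

lemma lintegral_gaussDensity_ne_zero : ∫⁻ u : I → ℝ, gaussDensity u ≠ 0 := by
  rw [Ne, lintegral_eq_zero_iff measurable_gaussDensity]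
  intro h
  have : ∀ u : I → ℝ, gaussDensity u ≠ 0 := fun u => by simp [gaussDensity, Real.exp_pos]
  have h' : ∀ᵐ u : I → ℝ, False := h.mono fun u hu => this u hu
  simp only [Filter.eventually_false_iff_eq_bot, ae_eq_bot] at h'
  exact (isOpen_univ.measure_ne_zero (volume : Measure (I → ℝ)) Set.univ_nonempty) (by simp [h'])

lemma lintegral_gaussDensity_ne_top : ∫⁻ u : I → ℝ, gaussDensity u ≠ ⊤ := by
  have h1 : Integrable fun u : I → ℝ => ∏ i, Real.exp (-(1 / 2) * u i ^ 2) :=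
    Integrable.fintype_prod (f := fun (_ : I) x => Real.exp (-(1 / 2) * x ^ 2))
      fun _ => integrable_exp_neg_mul_sq (by norm_num)
  refine ne_of_lt ?_
  convert h1.lintegral_lt_top using 3 with u
  rw [gaussDensity, ← Real.exp_sum]
  congr 2
  simp only [dotProduct, ← Finset.mul_sum, pow_two]
  ring

instance : IsProbabilityMeasure (gauss I) := ⟨by
  rw [gauss, Measure.smul_apply, withDensity_apply _ MeasurableSet.univ, Measure.restrict_univ,
    smul_eq_mul]
  exact ENNReal.inv_mul_cancel lintegral_gaussDensity_ne_zero lintegral_gaussDensity_ne_top⟩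

lemma lintegral_gauss {F : (I → ℝ) → ℝ≥0∞} (hF : Measurable F) :
    ∫⁻ u, F u ∂(gauss I) = (∫⁻ u : I → ℝ, gaussDensity u)⁻¹ * ∫⁻ u, gaussDensity u * F u := by
  rw [gauss, lintegral_smul_measure, lintegral_withDensity_eq_lintegral_mul _
    measurable_gaussDensity hF]
  rfl

/-- The Cameron–Martin formula for the standard Gaussian distribution. -/
lemma lintegral_gauss_translate {F : (I → ℝ) → ℝ≥0∞} (hF : Measurable F) (c : I → ℝ) :
    ∫⁻ u, F (c + u) * ENNReal.ofReal (Real.exp (-(c ⬝ᵥ u))) ∂(gauss I) =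
      ENNReal.ofReal (Real.exp ((c ⬝ᵥ c) / 2)) * ∫⁻ u, F u ∂(gauss I) := by
  have hm : Measurable fun u : I → ℝ => ENNReal.ofReal (Real.exp (-(c ⬝ᵥ u))) :=
    ENNReal.measurable_ofReal.comp (Real.measurable_exp.comp (measurable_dotProduct_left c).neg)
  have hFm : Measurable fun u => F (c + u) * ENNReal.ofReal (Real.exp (-(c ⬝ᵥ u))) :=
    (hF.comp (measurable_const_add c)).mul hm
  have hdF : Measurable fun u => gaussDensity u * F u := measurable_gaussDensity.mul hF
  rw [lintegral_gauss hFm, lintegral_gauss hF,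
    mul_left_comm, ← lintegral_const_mul _ hdF,
    ← lintegral_add_left_eq_self (fun u => ENNReal.ofReal (Real.exp ((c ⬝ᵥ c) / 2)) *
      (gaussDensity u * F u)) c]
  congr 1
  refine lintegral_congr fun u => ?_
  have hkey : gaussDensity u * ENNReal.ofReal (Real.exp (-(c ⬝ᵥ u))) =
      ENNReal.ofReal (Real.exp ((c ⬝ᵥ c) / 2)) * gaussDensity (c + u) := by
    simp only [gaussDensity]
    rw [← ENNReal.ofReal_mul (Real.exp_pos _).le, ← ENNReal.ofReal_mul (Real.exp_pos _).le,
      ← Real.exp_add, ← Real.exp_add]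
    congr 2
    rw [add_dotProduct, dotProduct_add, dotProduct_add, dotProduct_comm u c]
    ring
  rw [mul_left_comm, hkey]
  ring

lemma lintegral_exp_neg_dotProduct_gauss (c : I → ℝ) :
    ∫⁻ u, ENNReal.ofReal (Real.exp (-(c ⬝ᵥ u))) ∂(gauss I) =
      ENNReal.ofReal (Real.exp ((c ⬝ᵥ c) / 2)) := by
  have := lintegral_gauss_translate (I := I) (F := fun _ => 1) measurable_const c
  simpa using this

lemma gauss_dotProduct_gt_le (c : I → ℝ) {r t : ℝ} (hr : 0 < r) (ht : 0 ≤ t)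
    (hc : c ⬝ᵥ c ≤ r) :
    gauss I {u | t < c ⬝ᵥ u} ≤ ENNReal.ofReal (Real.exp (-(t ^ 2 / (2 * r)))) := by
  set s := t / r with hs
  have hs0 : 0 ≤ s := by positivity
  have h1 := lintegral_exp_neg_dotProduct_gauss (-(s • c))
  have hm : Measurable fun u : I → ℝ => ENNReal.ofReal (Real.exp (-(-(s • c) ⬝ᵥ u))) :=
    ENNReal.measurable_ofReal.comp (Real.measurable_exp.comp (measurable_dotProduct_left _).neg)
  have h2 := mul_meas_ge_le_lintegral (μ := gauss I) hm (ENNReal.ofReal (Real.exp (s * t)))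
  rw [h1] at h2
  have hsub : {u : I → ℝ | t < c ⬝ᵥ u} ⊆ {u | ENNReal.ofReal (Real.exp (s * t)) ≤
      ENNReal.ofReal (Real.exp (-(-(s • c) ⬝ᵥ u)))} := fun u hu => by
    refine ENNReal.ofReal_le_ofReal (Real.exp_le_exp.2 ?_)
    rw [neg_dotProduct, neg_neg, smul_dotProduct, smul_eq_mul]
    exact mul_le_mul_of_nonneg_left (le_of_lt hu) hs0
  refine (measure_mono hsub).trans ?_
  have h3 : ENNReal.ofReal (Real.exp ((-(s • c) ⬝ᵥ -(s • c)) / 2)) ≤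
      ENNReal.ofReal (Real.exp (s * t)) * ENNReal.ofReal (Real.exp (-(t ^ 2 / (2 * r)))) := by
    rw [← ENNReal.ofReal_mul (Real.exp_pos _).le, ← Real.exp_add]
    refine ENNReal.ofReal_le_ofReal (Real.exp_le_exp.2 ?_)
    rw [neg_dotProduct, dotProduct_neg, neg_neg, smul_dotProduct, dotProduct_smul, smul_eq_mul,
      smul_eq_mul]
    have h4 : s * (s * (c ⬝ᵥ c)) ≤ s * (s * r) := by gcongr
    have h5 : s * r = t := by rw [hs]; field_simp
    have h6 : t ^ 2 / (2 * r) = s * t / 2 := by rw [hs]; field_simp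
    rw [h6]
    rw [h5] at h4
    linarith
  exact (ENNReal.mul_le_mul_iff_right (by simp [Real.exp_pos]) ENNReal.ofReal_ne_top).1
    (h2.trans h3)

lemma measurePreserving_neg_gauss :
    MeasurePreserving (fun u : I → ℝ => -u) (gauss I) (gauss I) := by
  refine ⟨measurable_neg, Measure.ext fun s hs => ?_⟩
  rw [Measure.map_apply measurable_neg hs, ← lintegral_indicator_one hs,
    ← lintegral_indicator_one (measurable_neg hs),
    lintegral_gauss (measurable_one.indicator (measurable_neg hs)),
    lintegral_gauss (measurable_one.indicator hs),
    ← lintegral_neg_eq_self fun u => gaussDensity u * s.indicator 1 u]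
  congr 1
  refine lintegral_congr fun u => ?_
  have h1 : gaussDensity (-u) = gaussDensity u := by simp [gaussDensity]
  rw [h1]
  rfl

lemma integrable_dotProduct_gauss (c : I → ℝ) : Integrable (fun u => c ⬝ᵥ u) (gauss I) := by
  have h : ∀ c : I → ℝ, Integrable (fun u => Real.exp (-(c ⬝ᵥ u))) (gauss I) := fun c =>
    ⟨(Real.measurable_exp.comp (measurable_dotProduct_left c).neg).aestronglyMeasurable, by
      rw [hasFiniteIntegral_iff_ofReal (Filter.Eventually.of_forall fun _ => (Real.exp_pos _).le),
        lintegral_exp_neg_dotProduct_gauss]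
      exact ENNReal.ofReal_lt_top⟩
  refine ((h c).add (h (-c))).mono' (measurable_dotProduct_left c).aestronglyMeasurable
    (Filter.Eventually.of_forall fun u => ?_)
  rw [Real.norm_eq_abs, Pi.add_apply, neg_dotProduct, neg_neg, abs_le]
  have h1 := Real.add_one_le_exp (c ⬝ᵥ u)
  have h2 := Real.add_one_le_exp (-(c ⬝ᵥ u))
  have h3 := Real.exp_pos (c ⬝ᵥ u)
  have h4 := Real.exp_pos (-(c ⬝ᵥ u))
  constructor <;> linarith

lemma integral_dotProduct_gauss (c : I → ℝ) : ∫ u, c ⬝ᵥ u ∂(gauss I) = 0 := by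
  have h := measurePreserving_neg_gauss.integral_comp
    (MeasurableEquiv.neg (I → ℝ)).measurableEmbedding (fun u => c ⬝ᵥ u)
  simp only [dotProduct_neg, integral_neg] at h
  linarith

/-- The Donsker–Varadhan inequality for a translate of the standard Gaussian distribution. -/
lemma exp_integral_gauss_translate_le (c : I → ℝ) (b : (I → ℝ) → ℝ) (hb : Measurable b)
    (hbc : ∃ C, ∀ u, |b u| ≤ C) :
    ENNReal.ofReal (Real.exp (∫ u, b u ∂((gauss I).map (c + ·)))) ≤
      ENNReal.ofReal (Real.exp ((c ⬝ᵥ c) / 2)) *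
        ∫⁻ u, ENNReal.ofReal (Real.exp (b u)) ∂(gauss I) := by
  obtain ⟨C, hC⟩ := hbc
  have hbm : Measurable fun u => ENNReal.ofReal (Real.exp (b u)) :=
    ENNReal.measurable_ofReal.comp (Real.measurable_exp.comp hb)
  have hbt : Measurable fun u => b (c + u) := hb.comp (measurable_const_add c)
  have hbi : Integrable (fun u => b (c + u)) (gauss I) :=
    Integrable.of_bound hbt.aestronglyMeasurable C (Filter.Eventually.of_forall fun u => hC _)
  rw [integral_map (measurable_const_add c).aemeasurable hb.aestronglyMeasurable,
    ← lintegral_gauss_translate hbm c]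
  have hmul : ∀ u, ENNReal.ofReal (Real.exp (b (c + u))) * ENNReal.ofReal (Real.exp (-(c ⬝ᵥ u))) =
      ENNReal.ofReal (Real.exp (b (c + u) - c ⬝ᵥ u)) := fun u => by
    rw [← ENNReal.ofReal_mul (Real.exp_pos _).le, ← Real.exp_add, sub_eq_add_neg]
  simp only [hmul]
  have hdm := measurable_dotProduct_left c
  have hint : Integrable (fun u => Real.exp (b (c + u) - c ⬝ᵥ u)) (gauss I) := by
    refine ⟨(Real.measurable_exp.comp (hbt.sub hdm)).aestronglyMeasurable, ?_⟩
    rw [hasFiniteIntegral_iff_ofReal (Filter.Eventually.of_forall fun _ => (Real.exp_pos _).le)]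
    simp only [← hmul]
    rw [lintegral_gauss_translate hbm c]
    refine ENNReal.mul_lt_top ENNReal.ofReal_lt_top ?_
    refine lt_of_le_of_lt (lintegral_mono fun u => ENNReal.ofReal_le_ofReal
      (Real.exp_le_exp.2 (le_of_abs_le (hC u)))) ?_
    simp
  rw [← ofReal_integral_eq_lintegral_ofReal hint
    (Filter.Eventually.of_forall fun _ => (Real.exp_pos _).le)]
  refine ENNReal.ofReal_le_ofReal ?_
  have h1 : ∫ u, b (c + u) ∂(gauss I) = ∫ u, (b (c + u) - c ⬝ᵥ u) ∂(gauss I) := by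
    rw [integral_sub hbi (integrable_dotProduct_gauss c), integral_dotProduct_gauss, sub_zero]
  rw [h1]
  exact convexOn_exp.map_integral_le Real.continuous_exp.continuousOn isClosed_univ
    (Filter.Eventually.of_forall fun _ => Set.mem_univ _)
    (hbi.sub (integrable_dotProduct_gauss c)) hint

end Gaussian

/-! ### Spectral norms and Gaussian matrices -/

section Norms

variable {a b n : ℕ}

lemma vecLpNorm_two_sq (x : Fin n → ℝ) : vecLpNorm 2 x ^ 2 = x ⬝ᵥ x := by
  rw [vecLpNorm, EuclideanSpace.real_norm_sq_eq]
  simp [dotProduct, pow_two]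

lemma vecLpNorm_two_nonneg (x : Fin n → ℝ) : 0 ≤ vecLpNorm 2 x := norm_nonneg _

lemma vecLpNorm_two_eq_sqrt (x : Fin n → ℝ) : vecLpNorm 2 x = √(x ⬝ᵥ x) := by
  rw [← vecLpNorm_two_sq, Real.sqrt_sq (vecLpNorm_two_nonneg x)]

lemma vecLpNorm_two_zero : vecLpNorm 2 (0 : Fin n → ℝ) = 0 := by
  simp [vecLpNorm]

lemma vecLpNorm_two_eq_zero {x : Fin n → ℝ} (h : vecLpNorm 2 x = 0) : x = 0 := by
  simpa [vecLpNorm] using h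

lemma vecLpNorm_two_add_le (x y : Fin n → ℝ) :
    vecLpNorm 2 (x + y) ≤ vecLpNorm 2 x + vecLpNorm 2 y :=
  norm_add_le (WithLp.toLp 2 x) (WithLp.toLp 2 y)

lemma vecLpNorm_two_sub_comm (x y : Fin n → ℝ) : vecLpNorm 2 (x - y) = vecLpNorm 2 (y - x) :=
  norm_sub_rev (WithLp.toLp 2 x) (WithLp.toLp 2 y)

lemma vecLpNorm_two_smul (c : ℝ) (x : Fin n → ℝ) : vecLpNorm 2 (c • x) = |c| * vecLpNorm 2 x :=
  norm_smul c (WithLp.toLp 2 x)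

lemma dotProduct_le_vecLpNorm_two (x y : Fin n → ℝ) :
    x ⬝ᵥ y ≤ vecLpNorm 2 x * vecLpNorm 2 y := by
  have := real_inner_le_norm (WithLp.toLp 2 x) (WithLp.toLp 2 y)
  rw [EuclideanSpace.inner_toLp_toLp, star_trivial, dotProduct_comm] at this
  exact this

lemma abs_apply_le_vecLpNorm_two (x : Fin n → ℝ) (i : Fin n) : |x i| ≤ vecLpNorm 2 x :=
  PiLp.norm_apply_le (WithLp.toLp 2 x) i

lemma vecLpNorm_two_mono {x y : Fin n → ℝ} (h : ∀ i, |x i| ≤ |y i|) :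
    vecLpNorm 2 x ≤ vecLpNorm 2 y := by
  rw [vecLpNorm_two_eq_sqrt, vecLpNorm_two_eq_sqrt]
  refine Real.sqrt_le_sqrt (Finset.sum_le_sum fun i _ => ?_)
  have := sq_le_sq.2 (h i)
  simpa [pow_two] using this

lemma specNorm_nonneg (A : Matrix (Fin a) (Fin b) ℝ) : 0 ≤ specNorm A :=
  @norm_nonneg _ Matrix.instL2OpNormedAddCommGroup.toSeminormedAddCommGroup.toSeminormedAddGroup A

lemma vecLpNorm_two_mulVec_le (A : Matrix (Fin a) (Fin b) ℝ) (x : Fin b → ℝ) :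
    vecLpNorm 2 (A *ᵥ x) ≤ specNorm A * vecLpNorm 2 x :=
  A.l2_opNorm_mulVec (WithLp.toLp 2 x)

lemma specNorm_le {A : Matrix (Fin a) (Fin b) ℝ} {c : ℝ} (hc : 0 ≤ c)
    (h : ∀ x, vecLpNorm 2 (A *ᵥ x) ≤ c * vecLpNorm 2 x) : specNorm A ≤ c := by
  have := ContinuousLinearMap.opNorm_le_bound
    ((Matrix.toEuclideanLin (𝕜 := ℝ) (m := Fin a) (n := Fin b)).trans
      LinearMap.toContinuousLinearMap A) hc (fun x => h x.ofLp)
  exact this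

lemma specNorm_add_le (A B : Matrix (Fin a) (Fin b) ℝ) :
    specNorm (A + B) ≤ specNorm A + specNorm B := by
  refine specNorm_le (add_nonneg (specNorm_nonneg A) (specNorm_nonneg B)) fun x => ?_
  rw [Matrix.add_mulVec, add_mul]
  exact (vecLpNorm_two_add_le _ _).trans
    (add_le_add (vecLpNorm_two_mulVec_le A x) (vecLpNorm_two_mulVec_le B x))

lemma specNorm_smul_le (c : ℝ) (A : Matrix (Fin a) (Fin b) ℝ) :
    specNorm (c • A) ≤ |c| * specNorm A := by
  refine specNorm_le (mul_nonneg (abs_nonneg c) (specNorm_nonneg A)) fun x => ?_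
  rw [Matrix.smul_mulVec, vecLpNorm_two_smul, mul_assoc]
  exact mul_le_mul_of_nonneg_left (vecLpNorm_two_mulVec_le A x) (abs_nonneg c)

lemma frobNorm_nonneg (A : Matrix (Fin a) (Fin b) ℝ) : 0 ≤ frobNorm A := Real.sqrt_nonneg _

lemma frobNorm_sq (A : Matrix (Fin a) (Fin b) ℝ) : frobNorm A ^ 2 = ∑ i, ∑ j, A i j ^ 2 :=
  Real.sq_sqrt (Finset.sum_nonneg fun _ _ => Finset.sum_nonneg fun _ _ => sq_nonneg _)

lemma frobNorm_smul_sq (c : ℝ) (A : Matrix (Fin a) (Fin b) ℝ) :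
    frobNorm (c • A) ^ 2 = c ^ 2 * frobNorm A ^ 2 := by
  simp only [frobNorm_sq, Matrix.smul_apply, smul_eq_mul, mul_pow, Finset.mul_sum]

lemma specNorm_le_frobNorm (A : Matrix (Fin a) (Fin b) ℝ) : specNorm A ≤ frobNorm A := by
  refine specNorm_le (frobNorm_nonneg A) fun x => ?_
  refine abs_le_of_sq_le_sq' ?_ (mul_nonneg (frobNorm_nonneg A) (vecLpNorm_two_nonneg x)) |>.2
  rw [mul_pow, vecLpNorm_two_sq, vecLpNorm_two_sq, frobNorm_sq, Finset.sum_mul]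
  refine Finset.sum_le_sum fun i _ => ?_
  rw [← pow_two]
  refine (Finset.sum_mul_sq_le_sq_mul_sq Finset.univ (A i) x).trans (le_of_eq ?_)
  simp [dotProduct, pow_two]

lemma specNorm_le_of_bilinear {A : Matrix (Fin a) (Fin b) ℝ} {c : ℝ} (hc : 0 ≤ c)
    (h : ∀ w v, vecLpNorm 2 w ≤ 1 → vecLpNorm 2 v ≤ 1 → w ⬝ᵥ (A *ᵥ v) ≤ c) :
    specNorm A ≤ c := by
  refine specNorm_le hc fun x => ?_
  rcases (vecLpNorm_two_nonneg x).eq_or_lt with hx | hx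
  · rw [vecLpNorm_two_eq_zero hx.symm, Matrix.mulVec_zero, vecLpNorm_two_zero,
      vecLpNorm_two_zero, mul_zero]
  rcases (vecLpNorm_two_nonneg (A *ᵥ x)).eq_or_lt with hy | hy
  · rw [← hy]; positivity
  have hn : ∀ {k : ℕ} (z : Fin k → ℝ), 0 < vecLpNorm 2 z →
      vecLpNorm 2 ((vecLpNorm 2 z)⁻¹ • z) ≤ 1 := fun z hz => by
    rw [vecLpNorm_two_smul, abs_of_pos (inv_pos.2 hz), inv_mul_cancel₀ hz.ne']
  have h1 := h _ _ (hn _ hy) (hn _ hx)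
  rw [Matrix.mulVec_smul, dotProduct_smul, smul_dotProduct, ← vecLpNorm_two_sq, smul_eq_mul,
    smul_eq_mul] at h1
  rw [pow_two, inv_mul_cancel_left₀ hy.ne', inv_mul_le_iff₀ hx] at h1
  linarith

end Norms

section Net

/-- A `1/4`-net of the Euclidean unit ball made of vectors with integer multiples of
`1 / (4 * h)` as coordinates. Its cardinality is larger than that of an optimal net,
but the loss is only logarithmic in `h`. -/
lemma exists_grid_net {a h : ℕ} (hh : 1 ≤ h) (ha : a ≤ h) :
    ∃ s : Finset (Fin a → ℝ), s.card ≤ (9 * h) ^ h ∧ (∀ w ∈ s, vecLpNorm 2 w ≤ 5 / 4) ∧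
      ∀ v, vecLpNorm 2 v ≤ 1 → ∃ w ∈ s, vecLpNorm 2 (v - w) ≤ 1 / 4 := by
  classical
  have hh' : (1 : ℝ) ≤ h := by exact_mod_cast hh
  set f : (Fin a → ℤ) → Fin a → ℝ := fun z i => z i / (4 * h) with hf
  refine ⟨((Fintype.piFinset fun _ : Fin a => Finset.Icc (-(4 * h : ℤ)) (4 * h)).image f).filter
    fun w => vecLpNorm 2 w ≤ 5 / 4, ?_, fun w hw => (Finset.mem_filter.1 hw).2, fun v hv => ?_⟩
  · refine (Finset.card_filter_le _ _).trans (Finset.card_image_le.trans ?_)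
    rw [Fintype.card_piFinset]
    simp only [Int.card_Icc, Finset.prod_const, Finset.card_univ, Fintype.card_fin]
    have h1 : ((4 * h : ℤ) + 1 - -(4 * h)).toNat ≤ 9 * h := by omega
    exact (Nat.pow_le_pow_left h1 a).trans (Nat.pow_le_pow_right (by omega) ha)
  · set z : Fin a → ℤ := fun i => ⌊4 * h * v i⌋ with hz
    have hclose : vecLpNorm 2 (v - f z) ≤ 1 / 4 := by
      rw [vecLpNorm_two_eq_sqrt, Real.sqrt_le_left (by norm_num)]
      have hi : ∀ i, (v - f z) i * (v - f z) i ≤ (1 / (4 * h)) ^ 2 := fun i => by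
        have h1 := Int.floor_le (4 * h * v i)
        have h2 := Int.lt_floor_add_one (4 * h * v i)
        have h3 : (v - f z) i = (4 * h * v i - ⌊4 * h * v i⌋) / (4 * h) := by
          simp only [hf, hz, Pi.sub_apply]; field_simp
        rw [← pow_two, h3, div_pow, div_pow]
        gcongr
        linarith
      refine (Finset.sum_le_sum fun i _ => hi i).trans ?_
      have ha' : (a : ℝ) ≤ h := by exact_mod_cast ha
      simp only [Finset.sum_const, Finset.card_univ, Fintype.card_fin, nsmul_eq_mul]
      rw [div_pow, one_pow, mul_one_div, div_le_iff₀ (by positivity)]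
      nlinarith
    refine ⟨f z, Finset.mem_filter.2 ⟨Finset.mem_image.2 ⟨z, ?_, rfl⟩, ?_⟩, hclose⟩
    · rw [Fintype.mem_piFinset]
      intro i
      have h1 := abs_le.1 ((abs_apply_le_vecLpNorm_two v i).trans hv)
      rw [Finset.mem_Icc]
      constructor
      · refine Int.le_floor.2 ?_
        push_cast
        nlinarith
      · refine Int.cast_le (R := ℝ) |>.1 ((Int.floor_le _).trans ?_)
        push_cast
        nlinarith
    · have := vecLpNorm_two_add_le v (f z - v)
      rw [vecLpNorm_two_sub_comm, add_sub_cancel] at this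
      linarith

lemma specNorm_le_of_net {a b : ℕ} (A : Matrix (Fin a) (Fin b) ℝ) {t : ℝ} (ht : 0 ≤ t)
    (s : Finset (Fin a → ℝ)) (s' : Finset (Fin b → ℝ))
    (hs : ∀ w ∈ s, vecLpNorm 2 w ≤ 5 / 4)
    (hnet : ∀ v, vecLpNorm 2 v ≤ 1 → ∃ w ∈ s, vecLpNorm 2 (v - w) ≤ 1 / 4)
    (hnet' : ∀ v, vecLpNorm 2 v ≤ 1 → ∃ w ∈ s', vecLpNorm 2 (v - w) ≤ 1 / 4)
    (h : ∀ w ∈ s, ∀ v ∈ s', w ⬝ᵥ (A *ᵥ v) ≤ t) : specNorm A ≤ 3 * t := by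
  have hA := specNorm_nonneg A
  have key : specNorm A ≤ t + 9 / 16 * specNorm A := by
    refine specNorm_le_of_bilinear (by positivity) fun w v hw hv => ?_
    obtain ⟨w', hw', hww⟩ := hnet w hw
    obtain ⟨v', hv', hvv⟩ := hnet' v hv
    have h1 : w ⬝ᵥ (A *ᵥ v) = w' ⬝ᵥ (A *ᵥ v') + (w - w') ⬝ᵥ (A *ᵥ v) +
        w' ⬝ᵥ (A *ᵥ (v - v')) := by
      rw [Matrix.mulVec_sub, dotProduct_sub, sub_dotProduct]; ring
    have h2 : (w - w') ⬝ᵥ (A *ᵥ v) ≤ 1 / 4 * (specNorm A * 1) :=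
      (dotProduct_le_vecLpNorm_two _ _).trans (mul_le_mul hww
        ((vecLpNorm_two_mulVec_le A v).trans (mul_le_mul_of_nonneg_left hv hA))
        (vecLpNorm_two_nonneg _) (by norm_num))
    have h3 : w' ⬝ᵥ (A *ᵥ (v - v')) ≤ 5 / 4 * (specNorm A * (1 / 4)) :=
      (dotProduct_le_vecLpNorm_two _ _).trans (mul_le_mul (hs w' hw')
        ((vecLpNorm_two_mulVec_le A _).trans (mul_le_mul_of_nonneg_left hvv hA))
        (vecLpNorm_two_nonneg _) (by norm_num))
    have h4 := h w' hw' v' hv'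
    linarith
  linarith

/-- The union bound over a pair of nets for the spectral norm of a random matrix. -/
lemma measure_specNorm_gt_le {Ω : Type*} [MeasurableSpace Ω] (P : Measure Ω) {a b h : ℕ}
    (hh : 1 ≤ h) (ha : a ≤ h) (hb : b ≤ h) (Y : Ω → Matrix (Fin a) (Fin b) ℝ) {t : ℝ}
    (ht : 0 ≤ t) (E : ℝ≥0∞)
    (hY : ∀ w v, vecLpNorm 2 w ≤ 5 / 4 → vecLpNorm 2 v ≤ 5 / 4 →
      P {ω | t < w ⬝ᵥ (Y ω *ᵥ v)} ≤ E) :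
    P {ω | 3 * t < specNorm (Y ω)} ≤ ((9 * h) ^ (2 * h) : ℕ) * E := by
  obtain ⟨s, hs1, hs2, hs3⟩ := exists_grid_net hh ha
  obtain ⟨s', hs1', hs2', hs3'⟩ := exists_grid_net hh hb
  have hsub : {ω | 3 * t < specNorm (Y ω)} ⊆
      ⋃ p ∈ s ×ˢ s', {ω | t < p.1 ⬝ᵥ (Y ω *ᵥ p.2)} := fun ω hω => by
    by_contra hcon
    simp only [Set.mem_iUnion, Set.mem_ofPred_eq, not_exists, not_lt, Finset.mem_product,
      Prod.forall] at hcon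
    exact absurd (specNorm_le_of_net (Y ω) ht s s' hs2 hs3 hs3'
      fun w hw v hv => hcon w v ⟨hw, hv⟩) (not_le.2 hω)
  refine (measure_mono hsub).trans ((measure_biUnion_finset_le _ _).trans ?_)
  refine (Finset.sum_le_card_nsmul _ _ E fun p hp => ?_).trans ?_
  · rw [Finset.mem_product] at hp
    exact hY _ _ (hs2 _ hp.1) (hs2' _ hp.2)
  · rw [nsmul_eq_mul, Finset.card_product]
    refine mul_le_mul_left ?_ E
    have h1 : s.card * s'.card ≤ (9 * h) ^ (2 * h) := by
      rw [two_mul, pow_add]; exact Nat.mul_le_mul hs1 hs1'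
    exact_mod_cast h1

end Net

section GaussianMatrix

variable {I : Type*} [Fintype I] {a b : ℕ}

lemma gauss_bilinear_gt_le (j : Fin a × Fin b → I) (hj : Function.Injective j)
    (w : Fin a → ℝ) (v : Fin b → ℝ) {r t : ℝ} (hr : 0 < r) (ht : 0 ≤ t)
    (hwv : vecLpNorm 2 w * vecLpNorm 2 v ≤ r) :
    gauss I {u | t < w ⬝ᵥ ((Matrix.of fun i k => u (j (i, k))) *ᵥ v)} ≤
      ENNReal.ofReal (Real.exp (-(t ^ 2 / (2 * r ^ 2)))) := by
  set c : I → ℝ := Function.extend j (fun p => w p.1 * v p.2) 0 with hc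
  have hcj : ∀ p, c (j p) = w p.1 * v p.2 := fun p => hj.extend_apply _ _ p
  have hc0 : ∀ i, i ∉ Set.range j → c i = 0 := fun i hi => Function.extend_apply' _ _ _ hi
  have h1 : ∀ u : I → ℝ, w ⬝ᵥ ((Matrix.of fun i k => u (j (i, k))) *ᵥ v) = c ⬝ᵥ u := fun u => by
    simp only [dotProduct, Matrix.mulVec, Matrix.of_apply, Finset.mul_sum]
    rw [← Fintype.sum_prod_type' (f := fun x y => w x * (u (j (x, y)) * v y))]
    refine Fintype.sum_of_injective j hj _ _ (fun i hi => by rw [hc0 i hi, zero_mul]) fun p => ?_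
    rw [hcj]
    ring
  have h2 : c ⬝ᵥ c = (vecLpNorm 2 w * vecLpNorm 2 v) ^ 2 := by
    rw [mul_pow, vecLpNorm_two_sq, vecLpNorm_two_sq]
    simp only [dotProduct, Finset.sum_mul_sum]
    rw [← Fintype.sum_prod_type' (f := fun x y => w x * w x * (v y * v y))]
    refine (Fintype.sum_of_injective j hj _ _ (fun i hi => by rw [hc0 i hi, zero_mul])
      fun p => ?_).symm
    rw [hcj]
    ring
  simp only [h1]
  refine gauss_dotProduct_gt_le c (by positivity) ht ?_
  rw [h2]
  exact pow_le_pow_left₀ (mul_nonneg (vecLpNorm_two_nonneg _) (vecLpNorm_two_nonneg _)) hwv 2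

/-- The spectral norm of a Gaussian matrix with at most `h` rows and columns is of order
`√(h log h)`. The entries are those coordinates of the Gaussian vector that `j` selects. -/
lemma gauss_specNorm_gt_le {h : ℕ} (hh : 1 ≤ h) (ha : a ≤ h) (hb : b ≤ h)
    (j : Fin a × Fin b → I) (hj : Function.Injective j) {t : ℝ} (ht : 0 ≤ t) :
    gauss I {u | 3 * t < specNorm (Matrix.of fun i k => u (j (i, k)))} ≤
      ((9 * h) ^ (2 * h) : ℕ) * ENNReal.ofReal (Real.exp (-(t ^ 2 / 5))) := by
  refine measure_specNorm_gt_le (gauss I) hh ha hb _ ht _ fun w v hw hv => ?_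
  refine (gauss_bilinear_gt_le j hj w v (r := 25 / 16) (by norm_num) ht ?_).trans ?_
  · have := mul_le_mul hw hv (vecLpNorm_two_nonneg _) (by norm_num)
    linarith
  · refine ENNReal.ofReal_le_ofReal (Real.exp_le_exp.2 (neg_le_neg ?_))
    exact div_le_div_of_nonneg_left (sq_nonneg t) (by norm_num) (by norm_num)

/-- For a fixed vector `x` the image under a Gaussian matrix is bounded independently of the number
of columns. -/
lemma gauss_mulVec_gt_le {h : ℕ} (hh : 1 ≤ h) (ha : a ≤ h)
    (j : Fin a × Fin b → I) (hj : Function.Injective j) {t R : ℝ} (ht : 0 ≤ t) (hR : 0 < R)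
    (x : Fin b → ℝ) (hx : vecLpNorm 2 x ≤ R) :
    gauss I {u | 3 * (t * R) < vecLpNorm 2 ((Matrix.of fun i k => u (j (i, k))) *ᵥ x)} ≤
      ((9 * h) ^ (2 * h) : ℕ) * ENNReal.ofReal (Real.exp (-(t ^ 2 / 5))) := by
  -- regard the image as a matrix with one column
  set Y : (I → ℝ) → Matrix (Fin a) (Fin 1) ℝ := fun u => Matrix.of fun i _ =>
    ((Matrix.of fun i k => u (j (i, k))) *ᵥ x) i with hY
  have hYv : ∀ u v, Y u *ᵥ v = (Matrix.of fun i k => u (j (i, k))) *ᵥ (v 0 • x) := fun u v => by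
    rw [Matrix.mulVec_smul]
    ext i
    simp [hY, Matrix.mulVec, dotProduct, mul_comm]
  have hone : vecLpNorm 2 (fun _ : Fin 1 => (1 : ℝ)) = 1 := by
    rw [vecLpNorm_two_eq_sqrt]; simp [dotProduct]
  have hYn : ∀ u, vecLpNorm 2 ((Matrix.of fun i k => u (j (i, k))) *ᵥ x) ≤ specNorm (Y u) :=
    fun u => by
      have := vecLpNorm_two_mulVec_le (Y u) fun _ => 1
      rw [hYv, one_smul, hone, mul_one] at this
      exact this
  have hmain := measure_specNorm_gt_le (gauss I) hh ha hh Y (t := t * R) (by positivity)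
    (ENNReal.ofReal (Real.exp (-(t ^ 2 / 5)))) fun w v hw hv => by
      simp only [hYv]
      refine (gauss_bilinear_gt_le j hj w (v 0 • x) (r := 25 / 16 * R) (by positivity)
        (by positivity) ?_).trans ?_
      · rw [vecLpNorm_two_smul]
        have h0 := (abs_apply_le_vecLpNorm_two v 0).trans hv
        calc vecLpNorm 2 w * (|v 0| * vecLpNorm 2 x) ≤ 5 / 4 * (5 / 4 * R) := by
              have := vecLpNorm_two_nonneg x
              gcongr
          _ = _ := by ring
      · refine ENNReal.ofReal_le_ofReal (Real.exp_le_exp.2 (neg_le_neg ?_))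
        rw [div_le_div_iff₀ (by norm_num) (by positivity)]
        nlinarith [mul_nonneg (sq_nonneg t) (sq_nonneg R)]
  refine (measure_mono fun u hu => ?_).trans hmain
  exact lt_of_lt_of_le hu (hYn u)

end GaussianMatrix

/-! ### Layers, margins and perturbations of networks -/

section Relu

lemma vecLpNorm_two_relu_sub_le {n : ℕ} (v w : Fin n → ℝ) :
    vecLpNorm 2 (relu v - relu w) ≤ vecLpNorm 2 (v - w) :=
  vecLpNorm_two_mono fun i => abs_max_sub_max_le_abs (v i) (w i) 0

lemma vecLpNorm_two_relu_le {n : ℕ} (v : Fin n → ℝ) : vecLpNorm 2 (relu v) ≤ vecLpNorm 2 v :=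
  vecLpNorm_two_mono fun i => by
    have := abs_max_sub_max_le_abs (v i) 0 0
    simpa [relu] using this

lemma relu_smul {n : ℕ} {c : ℝ} (hc : 0 ≤ c) (v : Fin n → ℝ) : relu (c • v) = c • relu v := by
  ext i
  simp [relu, mul_max_of_nonneg _ _ hc]

lemma continuous_relu {n : ℕ} : Continuous (relu (n := n)) := by
  unfold relu; fun_prop

end Relu

section Layers

lemma layer_succ {d : ℕ} {N : Fin (d + 1) → ℕ} (W : Weights N) (x : Fin (N 0) → ℝ) (i : Fin d) :
    layer W x i.succ = W i *ᵥ (if (i : ℕ) = 0 then layer W x i.castSucc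
      else relu (layer W x i.castSucc)) := rfl

variable {e q : ℕ} {N : Fin (e + 2) → ℕ}

/-- The layers of the network whose first layer acts on a pair `(x, v)` by `(x, v) ↦ W_1 x + M v`;
level `i` is the output of layer `i + 1` before activation. The clean input enters through `x`, the
adversarial perturbation through `v`. -/
def augLayer (W : Weights N) (M : Matrix (Fin (N (Fin.succ 0))) (Fin q) ℝ) (x : Fin (N 0) → ℝ)
    (v : Fin q → ℝ) : ∀ i : Fin (e + 1), Fin (N i.succ) → ℝ :=
  Fin.induction (W 0 *ᵥ x + M *ᵥ v) (fun i y => W i.succ *ᵥ relu y)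

lemma augLayer_zero (W : Weights N) (M : Matrix (Fin (N (Fin.succ 0))) (Fin q) ℝ)
    (x : Fin (N 0) → ℝ) (v : Fin q → ℝ) : augLayer W M x v 0 = W 0 *ᵥ x + M *ᵥ v := rfl

lemma augLayer_succ (W : Weights N) (M : Matrix (Fin (N (Fin.succ 0))) (Fin q) ℝ)
    (x : Fin (N 0) → ℝ) (v : Fin q → ℝ) (i : Fin e) :
    augLayer W M x v i.succ = W i.succ *ᵥ relu (augLayer W M x v i.castSucc) := rfl

lemma layer_add_eq_augLayer (W : Weights N) (M : Matrix (Fin (N (Fin.succ 0))) (Fin q) ℝ)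
    (x x' : Fin (N 0) → ℝ) (v : Fin q → ℝ) (hv : M *ᵥ v = W 0 *ᵥ x') (i : Fin (e + 1)) :
    layer W (x + x') i.succ = augLayer W M x v i := by
  induction i using Fin.induction with
  | zero =>
    rw [augLayer_zero, hv]
    exact Matrix.mulVec_add (W 0) x x'
  | succ i ih =>
    rw [augLayer_succ, ← ih, layer_succ]
    rw [if_neg (by simp)]
    rfl

/-- The output of the network with augmented input. -/
def augNet (W : Weights N) (M : Matrix (Fin (N (Fin.succ 0))) (Fin q) ℝ) (x : Fin (N 0) → ℝ)
    (v : Fin q → ℝ) : Fin (N (Fin.last (e + 1))) → ℝ :=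
  augLayer W M x v (Fin.last e)

lemma net_add_eq_augNet (W : Weights N) (M : Matrix (Fin (N (Fin.succ 0))) (Fin q) ℝ)
    (x x' : Fin (N 0) → ℝ) (v : Fin q → ℝ) (hv : M *ᵥ v = W 0 *ᵥ x') :
    net W (x + x') = augNet W M x v :=
  layer_add_eq_augLayer W M x x' v hv (Fin.last e)

/-- Positive homogeneity of ReLU networks in each layer. -/
lemma layer_smul (W : Weights N) (c : Fin (e + 1) → ℝ) (hc : ∀ i, 0 ≤ c i) (x : Fin (N 0) → ℝ)
    (i : Fin (e + 1)) :
    layer (N := N) (fun i => c i • W i) x i.succ =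
      (∏ j ∈ Finset.Iic i, c j) • layer W x i.succ := by
  induction i using Fin.induction with
  | zero =>
    rw [layer_succ, layer_succ, if_pos (by simp), if_pos (by simp),
      show Finset.Iic (0 : Fin (e + 1)) = {0} from by ext j; simp, Finset.prod_singleton,
      Matrix.smul_mulVec]
    rfl
  | succ i ih =>
    have hI : Finset.Iic i.succ = insert i.succ (Finset.Iic i.castSucc) := by
      ext j
      simp only [Finset.mem_Iic, Finset.mem_insert, Fin.le_iff_val_le_val, Fin.ext_iff,
        Fin.val_succ, Fin.val_castSucc]
      omega
    rw [layer_succ, layer_succ, if_neg (by simp), if_neg (by simp), hI,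
      Finset.prod_insert (by simp [Fin.le_iff_val_le_val]), Matrix.smul_mulVec, mul_smul]
    congr 1
    have h1 : layer (N := N) (fun i => c i • W i) x i.succ.castSucc =
      (∏ j ∈ Finset.Iic i.castSucc, c j) • layer W x i.succ.castSucc := ih
    rw [h1, relu_smul (Finset.prod_nonneg fun j _ => hc j), Matrix.mulVec_smul]

lemma net_smul (W : Weights N) (c : Fin (e + 1) → ℝ) (hc : ∀ i, 0 ≤ c i) :
    net (N := N) (fun i => c i • W i) = fun x => (∏ j, c j) • net W x := by
  funext x
  have h := layer_smul W c hc x (Fin.last e)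
  rwa [show Finset.Iic (Fin.last e) = Finset.univ from by ext j; simp [Fin.le_last]] at h

lemma vecLpNorm_two_augLayer_le (W : Weights N) (M : Matrix (Fin (N (Fin.succ 0))) (Fin q) ℝ)
    (x : Fin (N 0) → ℝ) (v : Fin q → ℝ) {β R : ℝ} (hβ : 0 ≤ β)
    (hW : ∀ i : Fin e, specNorm (W i.succ) ≤ β)
    (h0 : vecLpNorm 2 (W 0 *ᵥ x + M *ᵥ v) ≤ β * R) (i : Fin (e + 1)) :
    vecLpNorm 2 (augLayer W M x v i) ≤ R * β ^ ((i : ℕ) + 1) := by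
  induction i using Fin.induction with
  | zero =>
    rw [augLayer_zero, Fin.val_zero, zero_add, pow_one, mul_comm]
    exact h0
  | succ i ih =>
    rw [augLayer_succ, Fin.val_succ, pow_succ' β (i + 1)]
    refine (vecLpNorm_two_mulVec_le _ _).trans ?_
    refine (mul_le_mul (hW i) ((vecLpNorm_two_relu_le _).trans ih) (vecLpNorm_two_nonneg _)
      hβ).trans (le_of_eq ?_)
    rw [Fin.val_castSucc]
    ring

/-- The effect of a perturbation of the weights by matrices of spectral norm at most `η` on the
layers of a network whose weight matrices have spectral norm at most `β`. -/
lemma vecLpNorm_two_augLayer_sub_le (W U : Weights N)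
    (M V : Matrix (Fin (N (Fin.succ 0))) (Fin q) ℝ)
    (x : Fin (N 0) → ℝ) (v : Fin q → ℝ) {β η R : ℝ} (hβ : 0 ≤ β) (hη : 0 ≤ η)
    (hW : ∀ i : Fin e, specNorm (W i.succ) ≤ β) (hU : ∀ i : Fin e, specNorm (U i.succ) ≤ η)
    (h0 : vecLpNorm 2 (W 0 *ᵥ x + M *ᵥ v) ≤ β * R)
    (h1 : vecLpNorm 2 (U 0 *ᵥ x + V *ᵥ v) ≤ η * R) (i : Fin (e + 1)) :
    vecLpNorm 2 (augLayer (W + U) (M + V) x v i - augLayer W M x v i) ≤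
      R * ((β + η) ^ ((i : ℕ) + 1) - β ^ ((i : ℕ) + 1)) := by
  induction i using Fin.induction with
  | zero =>
    have hWU : (W + U) 0 *ᵥ x = W 0 *ᵥ x + U 0 *ᵥ x := Matrix.add_mulVec (W 0) (U 0) x
    rw [augLayer_zero, augLayer_zero, hWU, Matrix.add_mulVec, Fin.val_zero, zero_add, pow_one,
      pow_one, show W 0 *ᵥ x + U 0 *ᵥ x + (M *ᵥ v + V *ᵥ v) - (W 0 *ᵥ x + M *ᵥ v) =
        U 0 *ᵥ x + V *ᵥ v by abel]
    linarith
  | succ i ih =>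
    have hl := vecLpNorm_two_augLayer_le W M x v hβ hW h0 i.castSucc
    rw [augLayer_succ, augLayer_succ, Fin.val_succ]
    rw [Fin.val_castSucc] at ih hl
    set y := augLayer W M x v i.castSucc
    set z := augLayer (W + U) (M + V) x v i.castSucc
    have hsplit : (W + U) i.succ *ᵥ relu z - W i.succ *ᵥ relu y =
        (W + U) i.succ *ᵥ (relu z - relu y) + U i.succ *ᵥ relu y := by
      rw [Matrix.mulVec_sub, Pi.add_apply, Matrix.add_mulVec _ _ (relu y)]
      abel
    rw [hsplit]
    have hWU : specNorm ((W + U) i.succ) ≤ β + η :=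
      (specNorm_add_le _ _).trans (add_le_add (hW i) (hU i))
    have h2 : vecLpNorm 2 ((W + U) i.succ *ᵥ (relu z - relu y)) ≤
        (β + η) * (R * ((β + η) ^ ((i : ℕ) + 1) - β ^ ((i : ℕ) + 1))) :=
      (vecLpNorm_two_mulVec_le _ _).trans (mul_le_mul hWU
        ((vecLpNorm_two_relu_sub_le _ _).trans ih) (vecLpNorm_two_nonneg _) (by positivity))
    have h3 : vecLpNorm 2 (U i.succ *ᵥ relu y) ≤ η * (R * β ^ ((i : ℕ) + 1)) :=
      (vecLpNorm_two_mulVec_le _ _).trans (mul_le_mul (hU i)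
        ((vecLpNorm_two_relu_le _).trans hl) (vecLpNorm_two_nonneg _) hη)
    refine (vecLpNorm_two_add_le _ _).trans ((add_le_add h2 h3).trans (le_of_eq ?_))
    ring

lemma add_pow_sub_pow_le {β k : ℝ} (hβ : 0 ≤ β) (hk : 0 ≤ k) (hk1 : k ≤ 1) (d : ℕ) (hd : 1 ≤ d) :
    (β + k * β / d) ^ d - β ^ d ≤ 2 * k * β ^ d := by
  have hd' : (0 : ℝ) < d := by exact_mod_cast hd
  have h1 : (1 + k / d) ^ d ≤ Real.exp k := by
    have h2 : 1 + k / d ≤ Real.exp (k / d) := by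
      have := Real.add_one_le_exp (k / d); linarith
    refine (pow_le_pow_left₀ (by positivity) h2 d).trans (le_of_eq ?_)
    rw [← Real.exp_nat_mul]
    congr 1
    field_simp
  have h3 : Real.exp k ≤ 1 + 2 * k := by
    have := (abs_le.1 (Real.abs_exp_sub_one_sub_id_le (x := k) (by rwa [abs_of_nonneg hk]))).2
    nlinarith
  rw [show β + k * β / d = β * (1 + k / d) by field_simp, mul_pow]
  nlinarith [pow_nonneg hβ d]

/-- The classification margin `z y - max_{j ≠ y} z j`. -/
def margin {k : ℕ} (z : Fin k → ℝ) (y : Fin k) : ℝ := z y - ⨆ j : {j : Fin k // j ≠ y}, z j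

lemma margin_sub_le {k : ℕ} (z z' : Fin k → ℝ) (y : Fin k) :
    margin z y - margin z' y ≤ 2 * vecLpNorm 2 (z - z') := by
  have h1 : z y - z' y ≤ vecLpNorm 2 (z - z') :=
    (le_abs_self _).trans (abs_apply_le_vecLpNorm_two (z - z') y)
  have h2 : (⨆ j : {j : Fin k // j ≠ y}, z' j) ≤
      (⨆ j : {j : Fin k // j ≠ y}, z j) + vecLpNorm 2 (z - z') := by
    rcases isEmpty_or_nonempty {j : Fin k // j ≠ y} with hE | hE
    · rw [Real.iSup_of_isEmpty, Real.iSup_of_isEmpty, zero_add]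
      exact vecLpNorm_two_nonneg _
    · refine ciSup_le fun j => ?_
      have h3 := le_iSup_of_finite (fun j : {j : Fin k // j ≠ y} => z j) j
      have h4 := (abs_le.1 (abs_apply_le_vecLpNorm_two (z - z') j)).1
      rw [Pi.sub_apply] at h4
      linarith
  unfold margin
  linarith

lemma margin_le {k : ℕ} (z : Fin k → ℝ) (y : Fin k) : margin z y ≤ 2 * vecLpNorm 2 z := by
  have h0 : margin (0 : Fin k → ℝ) y = 0 := by
    rcases isEmpty_or_nonempty {j : Fin k // j ≠ y} with hE | hE <;> simp [margin]
  have := margin_sub_le z 0 y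
  rwa [h0, sub_zero, sub_zero] at this

lemma continuous_margin {k : ℕ} (y : Fin k) : Continuous fun z : Fin k → ℝ => margin z y := by
  refine continuous_iff_continuousAt.2 fun z => ?_
  have hc : Continuous fun z' : Fin k → ℝ => 2 * vecLpNorm 2 (z' - z) := by
    have : Continuous fun x : Fin k → ℝ => vecLpNorm 2 x :=
      (PiLp.continuous_toLp 2 _).norm
    exact (this.comp (continuous_id.sub continuous_const)).const_mul 2
  refine tendsto_iff_dist_tendsto_zero.2 (squeeze_zero (fun _ => dist_nonneg) (fun z' => ?_)
    (by simpa [vecLpNorm_two_zero] using hc.tendsto z))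
  rw [Real.dist_eq, abs_le]
  have h1 := margin_sub_le z' z y
  have h2 := margin_sub_le z z' y
  rw [vecLpNorm_two_sub_comm] at h2
  constructor <;> linarith

lemma mem_robustErrorSet_iff {n k : ℕ} {p : ℝ≥0∞} {ε γ : ℝ} {f : (Fin n → ℝ) → Fin k → ℝ}
    {z : (Fin n → ℝ) × Fin k} :
    z ∈ robustErrorSet p ε γ f ↔
      ∃ x', vecLpNorm p x' ≤ ε ∧ margin (f (z.1 + x')) z.2 ≤ γ := by
  simp only [robustErrorSet, margin, Set.mem_ofPred_eq]
  constructor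
  · rintro ⟨x', h1, h2⟩
    exact ⟨x' - z.1, h1, by rw [add_sub_cancel]; linarith⟩
  · rintro ⟨x', h1, h2⟩
    exact ⟨z.1 + x', by rwa [add_sub_cancel_left], by linarith⟩

end Layers

section RowSpace

/-- Every matrix `A` with at most `h` rows can be replaced by a matrix with `h` columns with the
same images of Euclidean balls, and whose norms are not larger: restrict `A` to its row space and
identify the latter isometrically with a subspace of `ℝ^h`. -/
lemma exists_matrix_image_ball_eq {a n h : ℕ} (ha : a ≤ h) (A : Matrix (Fin a) (Fin n) ℝ) :
    ∃ M : Matrix (Fin a) (Fin h) ℝ, specNorm M ≤ specNorm A ∧ frobNorm M ≤ frobNorm A ∧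
      (∀ x, ∃ u, vecLpNorm 2 u ≤ vecLpNorm 2 x ∧ M *ᵥ u = A *ᵥ x) ∧
      ∀ u, ∃ x, vecLpNorm 2 x ≤ vecLpNorm 2 u ∧ A *ᵥ x = M *ᵥ u := by
  set r : Fin a → EuclideanSpace ℝ (Fin n) := fun i => WithLp.toLp 2 (A i) with hr
  set E := Submodule.span ℝ (Set.range r) with hE
  have hdim : Module.finrank ℝ E ≤ Module.finrank ℝ (EuclideanSpace ℝ (Fin h)) := by
    rw [finrank_euclideanSpace_fin]
    refine (finrank_range_le_card r).trans ?_
    rwa [Fintype.card_fin]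
  obtain ⟨ι⟩ : Nonempty (E →ₗᵢ[ℝ] EuclideanSpace ℝ (Fin h)) := by
    set b := stdOrthonormalBasis ℝ E
    set b' := stdOrthonormalBasis ℝ (EuclideanSpace ℝ (Fin h))
    have hon : Orthonormal ℝ fun i => b' (Fin.castLE hdim i) :=
      b'.orthonormal.comp _ (Fin.castLE_injective hdim)
    exact ⟨b.toBasis.constr ℝ (fun i => b' (Fin.castLE hdim i)) |>.isometryOfOrthonormal
      (v := b.toBasis) (by simp) (by
        convert hon using 1
        ext1 i
        simp)⟩
  set κ : EuclideanSpace ℝ (Fin n) →L[ℝ] EuclideanSpace ℝ (Fin h) :=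
    ι.toContinuousLinearMap ∘L E.orthogonalProjectionOnto with hκ
  have hκn : ∀ x, ‖κ x‖ ≤ ‖x‖ := fun x => by
    simp only [hκ, ContinuousLinearMap.comp_apply, LinearIsometry.coe_toContinuousLinearMap,
      LinearIsometry.norm_map]
    exact E.norm_orthogonalProjectionOnto_apply_le x
  have hκi : ∀ i x, inner ℝ (κ (r i)) (κ x) = inner ℝ (r i) x := fun i x => by
    simp only [hκ, ContinuousLinearMap.comp_apply, LinearIsometry.coe_toContinuousLinearMap,
      LinearIsometry.inner_map_map]
    have hri : r i ∈ E := Submodule.subset_span ⟨i, rfl⟩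
    rw [Submodule.orthogonalProjectionOnto_mem_subspace_eq_self (⟨r i, hri⟩ : E)]
    exact Submodule.inner_orthogonalProjectionOnto_eq_of_mem_left (⟨r i, hri⟩ : E) x
  set M : Matrix (Fin a) (Fin h) ℝ := Matrix.of fun i k => κ (r i) k with hM
  have hMv : ∀ u : EuclideanSpace ℝ (Fin h), M *ᵥ u.ofLp = fun i => inner ℝ (κ (r i)) u := fun u => by
    ext i
    simp [hM, Matrix.mulVec, dotProduct, PiLp.inner_apply, mul_comm]
  have hAv : ∀ x : EuclideanSpace ℝ (Fin n), A *ᵥ x.ofLp = fun i => inner ℝ (r i) x := fun x => by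
    ext i
    simp [hr, Matrix.mulVec, dotProduct, PiLp.inner_apply, mul_comm]
  have h2 : ∀ u, ∃ x, vecLpNorm 2 x ≤ vecLpNorm 2 u ∧ A *ᵥ x = M *ᵥ u := fun u => by
    refine ⟨(ContinuousLinearMap.adjoint κ (WithLp.toLp 2 u)).ofLp, ?_, ?_⟩
    · have h3 : ‖ContinuousLinearMap.adjoint κ‖ ≤ 1 := by
        rw [LinearIsometryEquiv.norm_map]
        exact κ.opNorm_le_bound zero_le_one fun x => by rw [one_mul]; exact hκn x
      have h4 := (ContinuousLinearMap.adjoint κ).le_of_opNorm_le h3 (WithLp.toLp 2 u)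
      rw [one_mul] at h4
      exact h4
    · rw [hAv, show M *ᵥ u = _ from hMv (WithLp.toLp 2 u)]
      ext i
      rw [ContinuousLinearMap.adjoint_inner_right]
  refine ⟨M, ?_, ?_, fun x => ?_, h2⟩
  · refine specNorm_le (specNorm_nonneg A) fun u => ?_
    obtain ⟨x, hx, hxu⟩ := h2 u
    rw [← hxu]
    exact (vecLpNorm_two_mulVec_le A x).trans
      (mul_le_mul_of_nonneg_left hx (specNorm_nonneg A))
  · refine Real.sqrt_le_sqrt (Finset.sum_le_sum fun i _ => ?_)
    have h5 := pow_le_pow_left₀ (norm_nonneg _) (hκn (r i)) 2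
    rw [EuclideanSpace.real_norm_sq_eq, EuclideanSpace.real_norm_sq_eq] at h5
    exact h5
  · refine ⟨(κ (WithLp.toLp 2 x)).ofLp, hκn (WithLp.toLp 2 x), ?_⟩
    rw [hMv, show A *ᵥ x = _ from hAv (WithLp.toLp 2 x)]
    ext i
    rw [hκi]

end RowSpace

/-! ### Networks with Gaussian noise on the weights -/

section Parameters

variable {e q : ℕ} {N : Fin (e + 2) → ℕ}

/-- The coordinates of a pair `(W, M)` consisting of the weights of a network and the matrix `M`
through which the adversarial perturbation enters the first layer. -/
abbrev ParamIndex (N : Fin (e + 2) → ℕ) (q : ℕ) : Type :=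
  (Fin (N (Fin.succ 0)) × Fin q) ⊕ (Σ i : Fin (e + 1), Fin (N i.succ) × Fin (N i.castSucc))

/-- The weights with given coordinates. -/
def weightsOf (u : ParamIndex N q → ℝ) : Weights N :=
  fun i => Matrix.of fun a b => u (Sum.inr ⟨i, (a, b)⟩)

/-- The perturbation matrix with given coordinates. -/
def sideOf (u : ParamIndex N q → ℝ) : Matrix (Fin (N (Fin.succ 0))) (Fin q) ℝ :=
  Matrix.of fun a b => u (Sum.inl (a, b))

/-- The coordinate vector of a pair `(W, M)`. -/
def params (W : Weights N) (M : Matrix (Fin (N (Fin.succ 0))) (Fin q) ℝ) : ParamIndex N q → ℝ :=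
  Sum.elim (fun p => M p.1 p.2) (fun p => W p.1 p.2.1 p.2.2)

lemma weightsOf_params (W : Weights N) (M : Matrix (Fin (N (Fin.succ 0))) (Fin q) ℝ) :
    weightsOf (params W M) = W := rfl

lemma sideOf_params (W : Weights N) (M : Matrix (Fin (N (Fin.succ 0))) (Fin q) ℝ) :
    sideOf (params W M) = M := rfl

lemma weightsOf_add (u v : ParamIndex N q → ℝ) : weightsOf (u + v) = weightsOf u + weightsOf v :=
  rfl

lemma sideOf_add (u v : ParamIndex N q → ℝ) : sideOf (u + v) = sideOf u + sideOf v := rfl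

lemma weightsOf_smul (c : ℝ) (u : ParamIndex N q → ℝ) (i : Fin (e + 1)) :
    weightsOf (c • u) i = c • weightsOf u i := rfl

lemma sideOf_smul (c : ℝ) (u : ParamIndex N q → ℝ) : sideOf (c • u) = c • sideOf u := rfl

lemma dotProduct_self_eq_frobNorm (u : ParamIndex N q → ℝ) :
    u ⬝ᵥ u = frobNorm (sideOf u) ^ 2 + ∑ i, frobNorm (weightsOf u i) ^ 2 := by
  simp only [frobNorm_sq]
  simp only [dotProduct, Fintype.sum_sum_type, Fintype.sum_prod_type,
    Fintype.sum_sigma, sideOf, weightsOf, Matrix.of_apply, pow_two]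

lemma specNorm_sideOf_sq_le (u : ParamIndex N q → ℝ) : specNorm (sideOf u) ^ 2 ≤ u ⬝ᵥ u := by
  rw [dotProduct_self_eq_frobNorm]
  have h1 := pow_le_pow_left₀ (specNorm_nonneg _) (specNorm_le_frobNorm (sideOf u)) 2
  have h2 : 0 ≤ ∑ i, frobNorm (weightsOf u i) ^ 2 := Finset.sum_nonneg fun _ _ => sq_nonneg _
  linarith

lemma specNorm_weightsOf_sq_le (u : ParamIndex N q → ℝ) (i : Fin (e + 1)) :
    specNorm (weightsOf u i) ^ 2 ≤ u ⬝ᵥ u := by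
  rw [dotProduct_self_eq_frobNorm]
  have h1 := pow_le_pow_left₀ (specNorm_nonneg _) (specNorm_le_frobNorm (weightsOf u i)) 2
  have h2 : frobNorm (weightsOf u i) ^ 2 ≤ ∑ i, frobNorm (weightsOf u i) ^ 2 :=
    Finset.single_le_sum (f := fun i => frobNorm (weightsOf u i) ^ 2)
      (fun _ _ => sq_nonneg _) (Finset.mem_univ i)
  have h3 := sq_nonneg (frobNorm (sideOf u))
  linarith

/-- The labelled examples on which some perturbation `v ∈ V` makes the margin of the network
`augNet W M` at most `γ`. -/
def advSet (V : Set (Fin q → ℝ)) (γ : ℝ) (W : Weights N)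
    (M : Matrix (Fin (N (Fin.succ 0))) (Fin q) ℝ) :
    Set ((Fin (N 0) → ℝ) × Fin (N (Fin.last (e + 1)))) :=
  {z | ∃ v ∈ V, margin (augNet W M z.1 v) z.2 ≤ γ}

lemma continuous_augLayer (i : Fin (e + 1)) :
    Continuous fun p : (ParamIndex N q → ℝ) × (Fin (N 0) → ℝ) × (Fin q → ℝ) =>
      augLayer (weightsOf p.1) (sideOf p.1) p.2.1 p.2.2 i := by
  have hW : ∀ i, Continuous fun p : (ParamIndex N q → ℝ) × (Fin (N 0) → ℝ) × (Fin q → ℝ) =>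
      weightsOf p.1 i := fun i => continuous_matrix fun a b =>
    (continuous_apply (Sum.inr ⟨i, (a, b)⟩ : ParamIndex N q)).comp continuous_fst
  have hM : Continuous fun p : (ParamIndex N q → ℝ) × (Fin (N 0) → ℝ) × (Fin q → ℝ) =>
      sideOf p.1 := continuous_matrix fun a b =>
    (continuous_apply (Sum.inl (a, b) : ParamIndex N q)).comp continuous_fst
  induction i using Fin.induction with
  | zero =>
    simp only [augLayer_zero]
    exact ((hW 0).matrix_mulVec (continuous_fst.comp continuous_snd)).add
      (hM.matrix_mulVec (continuous_snd.comp continuous_snd))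
  | succ i ih =>
    simp only [augLayer_succ]
    exact (hW i.succ).matrix_mulVec (continuous_relu.comp ih)

/-- Errors are measurable jointly in the parameters and the example: for a compact set of
perturbations they form a closed set. -/
lemma measurableSet_advSet {V : Set (Fin q → ℝ)} (hV : IsCompact V) (γ : ℝ) :
    MeasurableSet {p : (ParamIndex N q → ℝ) × ((Fin (N 0) → ℝ) × Fin (N (Fin.last (e + 1)))) |
      p.2 ∈ advSet V γ (weightsOf p.1) (sideOf p.1)} := by
  have hclosed : ∀ y, IsClosed {p : (ParamIndex N q → ℝ) × (Fin (N 0) → ℝ) |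
      (p.2, y) ∈ advSet V γ (weightsOf p.1) (sideOf p.1)} := fun y => by
    have : CompactSpace V := isCompact_iff_compactSpace.1 hV
    have hc : IsClosed {r : V × ((ParamIndex N q → ℝ) × (Fin (N 0) → ℝ)) |
        margin (augNet (weightsOf r.2.1) (sideOf r.2.1) r.2.2 r.1) y ≤ γ} := by
      refine isClosed_le ((continuous_margin y).comp ?_) continuous_const
      have hg : Continuous fun r : V × ((ParamIndex N q → ℝ) × (Fin (N 0) → ℝ)) =>
          (r.2.1, r.2.2, (r.1 : Fin q → ℝ)) := by fun_prop
      exact (continuous_augLayer (Fin.last e)).comp hg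
    convert isClosedMap_snd_of_compactSpace _ hc using 1
    ext p
    simp [advSet]
  have hU : {p : (ParamIndex N q → ℝ) × ((Fin (N 0) → ℝ) × Fin (N (Fin.last (e + 1)))) |
      p.2 ∈ advSet V γ (weightsOf p.1) (sideOf p.1)} = ⋃ y, (fun p => (p.1, p.2.1)) ⁻¹'
        {p : (ParamIndex N q → ℝ) × (Fin (N 0) → ℝ) |
          (p.2, y) ∈ advSet V γ (weightsOf p.1) (sideOf p.1)} ∩ (fun p => p.2.2) ⁻¹' {y} := by
    ext ⟨u, x, y⟩
    simp
  rw [hU]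
  refine MeasurableSet.iUnion fun y => ((hclosed y).measurableSet.preimage ?_).inter
    ((measurableSet_singleton y).preimage ?_) <;> fun_prop

end Parameters

section Stability

variable {e q : ℕ} {N : Fin (e + 2) → ℕ}

/-- The noise matrices are small: in spectral norm, except for the first weight matrix, which may
have many columns and is only controlled on the given input `x`. -/
def IsSmallNoise (τ r : ℝ) (x : Fin (N 0) → ℝ) (u : ParamIndex N q → ℝ) : Prop :=
  specNorm (sideOf u) ≤ τ ∧ vecLpNorm 2 (weightsOf u 0 *ᵥ x) ≤ τ * r ∧
    ∀ i : Fin e, specNorm (weightsOf u i.succ) ≤ τ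

/-- The union bound over the at most `e + 2` events that make up small noise. -/
lemma gauss_not_isSmallNoise_le {h : ℕ} (hh : 1 ≤ h) (hN : ∀ i : Fin (e + 1), N i.succ ≤ h)
    (hq : q ≤ h) {t r : ℝ} (ht : 0 ≤ t) (hr : 0 < r)
    (htail : (e + 2) * (9 * h : ℝ) ^ (2 * h) * Real.exp (-(t ^ 2 / 5)) ≤ 1 / 4)
    (x : Fin (N 0) → ℝ) (hx : vecLpNorm 2 x ≤ r) :
    gauss (ParamIndex N q) {u | ¬ IsSmallNoise (3 * t) r x u} ≤ ENNReal.ofReal (1 / 4) := by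
  obtain ⟨E, hE⟩ : ∃ E : ℝ≥0∞, E = ((9 * h) ^ (2 * h) : ℕ) *
    ENNReal.ofReal (Real.exp (-(t ^ 2 / 5))) := ⟨_, rfl⟩
  have h1' := gauss_specNorm_gt_le (I := ParamIndex N q) hh (hN 0) hq (fun p => Sum.inl p)
    Sum.inl_injective ht
  have h1 : gauss (ParamIndex N q) {u | 3 * t < specNorm (sideOf u)} ≤ E := by
    rw [hE]; exact h1'
  have h2' := gauss_mulVec_gt_le (I := ParamIndex N q) hh (hN 0)
    (fun p : Fin (N (Fin.succ 0)) × Fin (N (Fin.castSucc 0)) => Sum.inr ⟨0, p⟩)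
    (Sum.inr_injective.comp sigma_mk_injective) ht hr x hx
  have h2 : gauss (ParamIndex N q) {u | 3 * (t * r) < vecLpNorm 2 (weightsOf u 0 *ᵥ x)} ≤ E := by
    rw [hE]; exact h2'
  have h3 : ∀ i : Fin e, gauss (ParamIndex N q) {u | 3 * t < specNorm (weightsOf u i.succ)} ≤
      E := fun i => by
    have h3' := gauss_specNorm_gt_le (I := ParamIndex N q) hh (hN i.succ) (hN i.castSucc)
      (fun p => Sum.inr ⟨i.succ, p⟩) (Sum.inr_injective.comp sigma_mk_injective) ht
    rw [hE]; exact h3'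
  have hsub : {u : ParamIndex N q → ℝ | ¬ IsSmallNoise (3 * t) r x u} ⊆
      ({u | 3 * t < specNorm (sideOf u)} ∪
        {u | 3 * (t * r) < vecLpNorm 2 (weightsOf u 0 *ᵥ x)}) ∪
        ⋃ i : Fin e, {u | 3 * t < specNorm (weightsOf u i.succ)} := fun u hu => by
    by_contra hcon
    simp only [Set.mem_union, Set.mem_ofPred_eq, Set.mem_iUnion, not_or, not_exists,
      not_lt] at hcon
    exact hu ⟨hcon.1.1, by rw [mul_assoc]; exact hcon.1.2, hcon.2⟩
  calc gauss (ParamIndex N q) {u | ¬ IsSmallNoise (3 * t) r x u}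
      ≤ (E + E) + ∑ _i : Fin e, E := by
        refine (measure_mono hsub).trans ((measure_union_le _ _).trans (add_le_add
          ((measure_union_le _ _).trans (add_le_add h1 h2)) ?_))
        exact (measure_iUnion_fintype_le _ _).trans (Finset.sum_le_sum fun i _ => h3 i)
    _ = ENNReal.ofReal ((e + 2) * (9 * h : ℝ) ^ (2 * h) * Real.exp (-(t ^ 2 / 5))) := by
        have hE' : E = ENNReal.ofReal ((9 * h : ℝ) ^ (2 * h) * Real.exp (-(t ^ 2 / 5))) := by
          rw [hE, ENNReal.ofReal_mul (by positivity)]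
          congr 1
          rw [← ENNReal.ofReal_natCast]
          push_cast
          rfl
        rw [mul_assoc, ENNReal.ofReal_mul (by positivity), ← hE']
        have h4 : ENNReal.ofReal ((e : ℝ) + 2) = e + 2 := by
          rw [ENNReal.ofReal_add (by positivity) (by norm_num)]
          simp
        rw [h4]
        simp only [Finset.sum_const, Finset.card_univ, Fintype.card_fin, nsmul_eq_mul]
        ring
    _ ≤ ENNReal.ofReal (1 / 4) := ENNReal.ofReal_le_ofReal htail

/-- Small noise of the scale `σ` around parameters `σ • t` close to those of `(W, M)` changes the
margin by at most `γ / 4`. -/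
lemma abs_margin_sub_le {W : Weights N} {M : Matrix (Fin (N (Fin.succ 0))) (Fin q) ℝ}
    {b σ τ κ γ r s : ℝ} (hb : 0 ≤ b) (hσ : 0 < σ) (hτ : 1 ≤ τ) (hκ : 0 ≤ κ) (hκ1 : κ ≤ 1)
    (hr : 0 ≤ r) (hs : 0 ≤ s)
    (hστ : 2 * σ * τ = κ * b / (e + 1)) (hγ : 16 * κ * (r + s) * b ^ (e + 1) ≤ γ)
    (hW : ∀ i, specNorm (W i) ≤ b) (hM : specNorm M ≤ b) (t u : ParamIndex N q → ℝ)
    (ht : (σ⁻¹ • params W M - t) ⬝ᵥ (σ⁻¹ • params W M - t) ≤ 1)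
    {x : Fin (N 0) → ℝ} (hx : vecLpNorm 2 x ≤ r) (hu : IsSmallNoise τ r x u) {v : Fin q → ℝ}
    (hv : vecLpNorm 2 v ≤ s) (y : Fin (N (Fin.last (e + 1)))) :
    |margin (augNet (weightsOf (σ • (t + u))) (sideOf (σ • (t + u))) x v) y -
      margin (augNet W M x v) y| ≤ γ / 4 := by
  set c := t - σ⁻¹ • params W M with hc
  have hcc : c ⬝ᵥ c ≤ 1 := by
    rw [hc, ← neg_sub, neg_dotProduct, dotProduct_neg, neg_neg]
    exact ht
  set n := σ • (c + u) with hn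
  have hsplit : σ • (t + u) = params W M + n := by
    rw [hn, hc, smul_add, smul_add, smul_sub, smul_inv_smul₀ hσ.ne']
    abel
  have hc1 : ∀ i, specNorm (weightsOf c i) ≤ 1 := fun i => by
    have := specNorm_weightsOf_sq_le c i
    nlinarith [specNorm_nonneg (weightsOf c i)]
  have hc2 : specNorm (sideOf c) ≤ 1 := by
    have := specNorm_sideOf_sq_le c
    nlinarith [specNorm_nonneg (sideOf c)]
  set η := κ * b / (e + 1) with hη
  have hη0 : 0 ≤ η := by positivity
  have hnU : ∀ i : Fin e, specNorm (weightsOf n i.succ) ≤ η := fun i => by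
    rw [hn, weightsOf_smul, weightsOf_add]
    refine (specNorm_smul_le _ _).trans ?_
    rw [abs_of_pos hσ, ← hστ]
    have h1 := specNorm_add_le (weightsOf c i.succ) (weightsOf u i.succ)
    have h2 := hc1 i.succ
    have h3 := hu.2.2 i
    rw [Pi.add_apply]
    nlinarith
  have hnV : specNorm (sideOf n) ≤ η := by
    rw [hn, sideOf_smul, sideOf_add]
    refine (specNorm_smul_le _ _).trans ?_
    rw [abs_of_pos hσ, ← hστ]
    have h1 := specNorm_add_le (sideOf c) (sideOf u)
    have h3 := hu.1
    nlinarith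
  have hn0 : vecLpNorm 2 (weightsOf n 0 *ᵥ x) ≤ η * r := by
    have h0 : weightsOf n 0 *ᵥ x = σ • (weightsOf c 0 *ᵥ x + weightsOf u 0 *ᵥ x) := by
      have h1 : weightsOf (c + u) 0 *ᵥ x = weightsOf c 0 *ᵥ x + weightsOf u 0 *ᵥ x :=
        Matrix.add_mulVec (weightsOf c 0) (weightsOf u 0) x
      rw [← h1, hn]
      exact Matrix.smul_mulVec σ (weightsOf (c + u) 0) x
    rw [h0, vecLpNorm_two_smul, abs_of_pos hσ, ← hστ]
    have h1 := vecLpNorm_two_add_le (weightsOf c 0 *ᵥ x) (weightsOf u 0 *ᵥ x)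
    have h2 : vecLpNorm 2 (weightsOf c 0 *ᵥ x) ≤ 1 * r :=
      (vecLpNorm_two_mulVec_le _ _).trans
        (mul_le_mul (hc1 0) hx (vecLpNorm_two_nonneg _) zero_le_one)
    have h3 := hu.2.1
    have h4 : r ≤ τ * r := le_mul_of_one_le_left hr hτ
    have h5 : σ * vecLpNorm 2 (weightsOf c 0 *ᵥ x + weightsOf u 0 *ᵥ x) ≤ σ * (τ * r + τ * r) :=
      mul_le_mul_of_nonneg_left (by linarith) hσ.le
    linarith
  have h0 : vecLpNorm 2 (W 0 *ᵥ x + M *ᵥ v) ≤ b * (r + s) := by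
    refine (vecLpNorm_two_add_le _ _).trans ?_
    rw [mul_add]
    exact add_le_add
      ((vecLpNorm_two_mulVec_le _ _).trans (mul_le_mul (hW 0) hx (vecLpNorm_two_nonneg _) hb))
      ((vecLpNorm_two_mulVec_le _ _).trans (mul_le_mul hM hv (vecLpNorm_two_nonneg _) hb))
  have h1 : vecLpNorm 2 (weightsOf n 0 *ᵥ x + sideOf n *ᵥ v) ≤ η * (r + s) := by
    refine (vecLpNorm_two_add_le _ _).trans ?_
    rw [mul_add]
    exact add_le_add hn0
      ((vecLpNorm_two_mulVec_le _ _).trans (mul_le_mul hnV hv (vecLpNorm_two_nonneg _) hη0))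
  have hmain := vecLpNorm_two_augLayer_sub_le W (weightsOf n) M (sideOf n) x v hb hη0
    (fun i => hW i.succ) hnU h0 h1 (Fin.last e)
  have hpow := add_pow_sub_pow_le hb hκ hκ1 (e + 1) (by omega)
  rw [Nat.cast_add, Nat.cast_one, ← hη] at hpow
  rw [Fin.val_last] at hmain
  have hdiff : vecLpNorm 2 (augNet (weightsOf (σ • (t + u))) (sideOf (σ • (t + u))) x v -
      augNet W M x v) ≤ γ / 8 := by
    rw [hsplit, weightsOf_add, sideOf_add, weightsOf_params, sideOf_params]
    refine hmain.trans ?_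
    have := mul_le_mul_of_nonneg_left hpow (add_nonneg hr hs)
    linarith
  rw [abs_le]
  have h2 := margin_sub_le (augNet (weightsOf (σ • (t + u))) (sideOf (σ • (t + u))) x v)
    (augNet W M x v) y
  have h3 := margin_sub_le (augNet W M x v)
    (augNet (weightsOf (σ • (t + u))) (sideOf (σ • (t + u))) x v) y
  rw [vecLpNorm_two_sub_comm] at h3
  constructor <;> linarith

end Stability

/-! ### Posterior means of the adversarial error -/

section Posterior

variable {e q : ℕ} {N : Fin (e + 2) → ℕ}

/-- The indicator of the adversarial errors at margin `γ` of the network with parameters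
`σ • u`. -/
def advLoss (V : Set (Fin q → ℝ)) (γ σ : ℝ) (u : ParamIndex N q → ℝ)
    (z : (Fin (N 0) → ℝ) × Fin (N (Fin.last (e + 1)))) : ℝ :=
  (advSet V γ (weightsOf (σ • u)) (sideOf (σ • u))).indicator 1 z

lemma measurable_advLoss {V : Set (Fin q → ℝ)} (hV : IsCompact V) (γ σ : ℝ) :
    Measurable (Function.uncurry (advLoss (N := N) V γ σ)) := by
  have h1 : Measurable fun p : (ParamIndex N q → ℝ) ×
      ((Fin (N 0) → ℝ) × Fin (N (Fin.last (e + 1)))) => (σ • p.1, p.2) := by fun_prop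
  have h2 := (measurable_one (α := ℝ)).indicator (measurableSet_advSet (N := N) hV γ)
  have h3 := h2.comp h1
  convert h3 using 1
  funext ⟨u, z⟩
  simp only [Function.comp_apply, Function.uncurry, advLoss, Set.indicator, Set.mem_ofPred_eq,
    Pi.one_apply]

lemma integral_advLoss_translate {V : Set (Fin q → ℝ)} (hV : IsCompact V) (γ σ : ℝ)
    (t : ParamIndex N q → ℝ) (z : (Fin (N 0) → ℝ) × Fin (N (Fin.last (e + 1)))) :
    ∫ u, advLoss V γ σ u z ∂((gauss (ParamIndex N q)).map (t + ·)) =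
      (gauss (ParamIndex N q)).real
        {u | z ∈ advSet V γ (weightsOf (σ • (t + u))) (sideOf (σ • (t + u)))} := by
  have hm : Measurable fun u : ParamIndex N q → ℝ => advLoss V γ σ u z := by
    have h0 : Measurable fun u : ParamIndex N q → ℝ => (u, z) := measurable_prodMk_right
    have h1 := (measurable_advLoss (N := N) hV γ σ).comp h0
    exact h1
  have h1 : Measurable fun u : ParamIndex N q → ℝ => (σ • (t + u), z) := by fun_prop
  have h2 : MeasurableSet
      {u | z ∈ advSet V γ (weightsOf (σ • (t + u))) (sideOf (σ • (t + u)))} := by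
    have h3 := (measurableSet_advSet (N := N) hV γ).preimage h1
    exact h3
  rw [integral_map (measurable_const_add t).aemeasurable hm.aestronglyMeasurable,
    ← integral_indicator_one h2]
  refine integral_congr_ae (Filter.Eventually.of_forall fun u => ?_)
  simp only [advLoss, Set.indicator, Set.mem_ofPred_eq, Pi.one_apply]

variable {W : Weights N} {M : Matrix (Fin (N (Fin.succ 0))) (Fin q) ℝ}
    {V : Set (Fin q → ℝ)} {b σ τ κ γ r s : ℝ} {t : ParamIndex N q → ℝ}
    {x : Fin (N 0) → ℝ} {y : Fin (N (Fin.last (e + 1)))}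

/-- An error of the network at margin `0` is an error at margin `γ / 2` of the perturbed networks,
except on an event of probability `1 / 4`, on which the noise is not small. -/
lemma ramp_integral_eq_one_of_mem (hV : IsCompact V) (hγ0 : 0 ≤ γ)
    (hclose : ∀ u, IsSmallNoise τ r x u → ∀ v ∈ V,
      |margin (augNet (weightsOf (σ • (t + u))) (sideOf (σ • (t + u))) x v) y -
        margin (augNet W M x v) y| ≤ γ / 4)
    (hnoise : gauss (ParamIndex N q) {u | ¬ IsSmallNoise τ r x u} ≤ ENNReal.ofReal (1 / 4))
    (hz : (x, y) ∈ advSet V 0 W M) :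
    ramp (∫ u, advLoss V (γ / 2) σ u (x, y) ∂((gauss (ParamIndex N q)).map (t + ·))) = 1 := by
  refine ramp_eq_one ?_
  rw [integral_advLoss_translate hV]
  set A := {u | (x, y) ∈ advSet V (γ / 2) (weightsOf (σ • (t + u))) (sideOf (σ • (t + u)))}
  have hAc : (gauss (ParamIndex N q)).real Aᶜ ≤ 1 / 4 := by
    refine ENNReal.toReal_le_of_le_ofReal (by norm_num) ((measure_mono ?_).trans hnoise)
    intro u hu hsmall
    obtain ⟨v, hv, hvm⟩ := hz
    refine hu ⟨v, hv, ?_⟩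
    have := (abs_le.1 (hclose u hsmall v hv)).2
    simp only at hvm ⊢
    linarith
  have h1 := measureReal_union_le (μ := gauss (ParamIndex N q)) A Aᶜ
  rw [Set.union_compl_self, probReal_univ] at h1
  linarith

lemma ramp_integral_eq_zero_of_notMem (hV : IsCompact V) (hγ0 : 0 < γ)
    (hclose : ∀ u, IsSmallNoise τ r x u → ∀ v ∈ V,
      |margin (augNet (weightsOf (σ • (t + u))) (sideOf (σ • (t + u))) x v) y -
        margin (augNet W M x v) y| ≤ γ / 4)
    (hnoise : gauss (ParamIndex N q) {u | ¬ IsSmallNoise τ r x u} ≤ ENNReal.ofReal (1 / 4))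
    (hz : (x, y) ∉ advSet V γ W M) :
    ramp (∫ u, advLoss V (γ / 2) σ u (x, y) ∂((gauss (ParamIndex N q)).map (t + ·))) = 0 := by
  refine ramp_eq_zero ?_
  rw [integral_advLoss_translate hV]
  refine ENNReal.toReal_le_of_le_ofReal (by norm_num) ((measure_mono ?_).trans hnoise)
  rintro u ⟨v, hv, hvm⟩ hsmall
  refine hz ⟨v, hv, ?_⟩
  have := (abs_le.1 (hclose u hsmall v hv)).1
  simp only at hvm ⊢
  linarith

/-- A finite net, at the scale of the noise, of the parameters with bounded Euclidean norm. -/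
lemma exists_finset_net {I : Type*} [Fintype I] (K : ℝ) :
    ∃ s : Finset (I → ℝ), (∀ t ∈ s, t ⬝ᵥ t ≤ K) ∧
      ∀ θ : I → ℝ, θ ⬝ᵥ θ ≤ K → ∃ t ∈ s, (θ - t) ⬝ᵥ (θ - t) ≤ 1 := by
  have hcont : Continuous fun θ : I → ℝ => θ ⬝ᵥ θ := by unfold dotProduct; fun_prop
  have hcomp : IsCompact {θ : I → ℝ | θ ⬝ᵥ θ ≤ K} := by
    refine Metric.isCompact_of_isClosed_isBounded (isClosed_le hcont continuous_const) ?_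
    refine (Metric.isBounded_iff_subset_closedBall 0).2 ⟨1 + K, fun θ hθ => ?_⟩
    have hθ' : ∑ i, θ i * θ i ≤ K := hθ
    have hK : 0 ≤ K := (Finset.sum_nonneg fun i _ => mul_self_nonneg (θ i)).trans hθ'
    rw [mem_closedBall_zero_iff, pi_norm_le_iff_of_nonneg (by linarith)]
    intro i
    have h1 : θ i * θ i ≤ K := (Finset.single_le_sum (f := fun i => θ i * θ i)
      (fun i _ => mul_self_nonneg (θ i)) (Finset.mem_univ i)).trans hθ'
    rw [Real.norm_eq_abs, abs_le]
    constructor <;> nlinarith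
  obtain ⟨s, hs, hcov⟩ := hcomp.elim_nhds_subcover
    (fun t => {θ : I → ℝ | (θ - t) ⬝ᵥ (θ - t) < 1}) fun t _ => by
      refine IsOpen.mem_nhds (isOpen_lt (hcont.comp (continuous_id.sub continuous_const))
        continuous_const) ?_
      simp
  refine ⟨s, hs, fun θ hθ => ?_⟩
  obtain ⟨t, ht, hθt⟩ := Set.mem_iUnion₂.1 (hcov hθ)
  exact ⟨t, ht, le_of_lt hθt⟩

/-- The generalization bound for a fixed noise level `σ` and a fixed bound `K` on the divergence of
posterior and prior. -/
lemma measure_deviation_fixed_scale_le {h m : ℕ} (hh : 1 ≤ h)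
    (hN : ∀ i : Fin (e + 1), N i.succ ≤ h) (hq : q ≤ h) (hm : 1 ≤ m)
    (D : Measure ((Fin (N 0) → ℝ) × Fin (N (Fin.last (e + 1))))) [IsProbabilityMeasure D]
    (hV : IsCompact V) (hVs : ∀ v ∈ V, vecLpNorm 2 v ≤ s) {ν K L : ℝ}
    (hb : 0 ≤ b) (hσ : 0 < σ) (hν : 0 ≤ ν) (hν1 : 1 ≤ 3 * ν) (hκ : 0 ≤ κ) (hκ1 : κ ≤ 1)
    (hr : 0 < r) (hs : 0 ≤ s)
    (htail : (e + 2) * (9 * h : ℝ) ^ (2 * h) * Real.exp (-(ν ^ 2 / 5)) ≤ 1 / 4)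
    (hστ : 2 * σ * (3 * ν) = κ * b / (e + 1)) (hγ : 16 * κ * (r + s) * b ^ (e + 1) ≤ γ)
    (hγ0 : 0 < γ) (hKL : 0 < K + L) (hD : ∀ᵐ z ∂D, vecLpNorm 2 z.1 ≤ r) :
    Measure.pi (fun _ : Fin m => D) {S | ¬ ((∀ i, vecLpNorm 2 (S i).1 ≤ r) →
      ∀ (W : Weights N) (M : Matrix (Fin (N (Fin.succ 0))) (Fin q) ℝ),
        (∀ i, specNorm (W i) ≤ b) → specNorm M ≤ b →
        params W M ⬝ᵥ params W M ≤ 2 * K * σ ^ 2 →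
        m * D.real (advSet V 0 W M) - ∑ i, (advSet V γ W M).indicator (fun _ => (1 : ℝ)) (S i) ≤
          √(32 * m * (K + L)))} ≤ ENNReal.ofReal (Real.exp (-L)) := by
  classical
  obtain ⟨T, hT, hnet⟩ := exists_finset_net (I := ParamIndex N q) (2 * K)
  set Q : T → Measure (ParamIndex N q → ℝ) := fun t =>
    (gauss (ParamIndex N q)).map ((t : ParamIndex N q → ℝ) + ·) with hQ
  have hQp : ∀ t, IsProbabilityMeasure (Q t) := fun t =>
    Measure.isProbabilityMeasure_map (measurable_const_add _).aemeasurable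
  have hind : ∀ u z, advLoss (N := N) V (γ / 2) σ u z = 0 ∨ advLoss V (γ / 2) σ u z = 1 :=
    fun u z => by
      unfold advLoss
      by_cases hz : z ∈ advSet V (γ / 2) (weightsOf (σ • u)) (sideOf (σ • u)) <;> simp [hz]
  have hdev := measure_exists_deviation_le D (gauss (ParamIndex N q)) Q K (fun t c hc hcb => by
      refine (exp_integral_gauss_translate_le (t : ParamIndex N q → ℝ) c hc hcb).trans ?_
      gcongr
      have := hT t t.2
      linarith)
    (advLoss V (γ / 2) σ) (measurable_advLoss hV _ _)
    (fun u z => by rcases hind u z with h1 | h1 <;> rw [h1]; exact zero_le_one)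
    (fun u z => by rcases hind u z with h1 | h1 <;> rw [h1]; exact zero_le_one) m hm L hKL
  refine (measure_mono fun S hS => ?_).trans hdev
  by_contra hcon
  refine hS fun hSr W M hW hM hWM => ?_
  obtain ⟨t, htT, ht⟩ := hnet (σ⁻¹ • params W M) (by
    rw [smul_dotProduct, dotProduct_smul, smul_eq_mul, smul_eq_mul, ← mul_assoc, ← mul_inv,
      inv_mul_le_iff₀ (by positivity)]
    linarith)
  simp only [Set.mem_ofPred_eq, not_exists, not_lt] at hcon
  have hcon' := hcon ⟨t, htT⟩
  set f : (Fin (N 0) → ℝ) × Fin (N (Fin.last (e + 1))) → ℝ := fun z =>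
    ramp (∫ u, advLoss V (γ / 2) σ u z ∂(Q ⟨t, htT⟩)) with hf
  have hclose : ∀ z : (Fin (N 0) → ℝ) × Fin (N (Fin.last (e + 1))), vecLpNorm 2 z.1 ≤ r →
      ∀ u, IsSmallNoise (3 * ν) r z.1 u → ∀ v ∈ V,
      |margin (augNet (weightsOf (σ • (t + u))) (sideOf (σ • (t + u))) z.1 v) z.2 -
        margin (augNet W M z.1 v) z.2| ≤ γ / 4 := fun z hz u hu v hv =>
    abs_margin_sub_le hb hσ hν1 hκ hκ1 hr.le hs hστ hγ hW hM t u ht hz hu (hVs v hv) z.2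
  have hone : ∀ z, vecLpNorm 2 z.1 ≤ r → z ∈ advSet V 0 W M → f z = 1 := fun z hz hmem =>
    ramp_integral_eq_one_of_mem hV hγ0.le (hclose z hz)
      (gauss_not_isSmallNoise_le hh hN hq hν hr htail z.1 hz) hmem
  have hzero : ∀ z, vecLpNorm 2 z.1 ≤ r → z ∉ advSet V γ W M → f z = 0 := fun z hz hmem =>
    ramp_integral_eq_zero_of_notMem hV hγ0 (hclose z hz)
      (gauss_not_isSmallNoise_le hh hN hq hν hr htail z.1 hz) hmem
  have hfm : Measurable f := by
    have : StronglyMeasurable (Function.uncurry fun z u => advLoss (N := N) V (γ / 2) σ u z) :=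
      ((measurable_advLoss hV _ _).comp measurable_swap).stronglyMeasurable
    exact continuous_ramp.measurable.comp
      (this.integral_prod_right (ν := Q ⟨t, htT⟩)).measurable
  have hfi : Integrable f D := by
    refine Integrable.of_bound hfm.aestronglyMeasurable 1 (Filter.Eventually.of_forall fun z => ?_)
    rw [Real.norm_of_nonneg (ramp_nonneg _)]
    exact ramp_le_one _
  have hpop : D.real (advSet V 0 W M) ≤ ∫ z, f z ∂D := by
    have hset : MeasurableSet {z | f z = 1} := hfm (measurableSet_singleton 1)
    calc D.real (advSet V 0 W M) ≤ D.real {z | f z = 1} := by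
          refine ENNReal.toReal_mono (measure_ne_top _ _) (measure_mono_ae ?_)
          filter_upwards [hD] with z hz hmem
          exact hone z hz hmem
      _ = ∫ z, {z | f z = 1}.indicator 1 z ∂D := (integral_indicator_one hset).symm
      _ ≤ ∫ z, f z ∂D := by
          refine integral_mono ((integrable_const (1 : ℝ)).indicator hset) hfi fun z => ?_
          by_cases hz : f z = 1
          · simp [hz]
          · simp only [Set.indicator, Set.mem_ofPred_eq, hz, if_false]
            exact ramp_nonneg _
  have hemp : ∑ i, f (S i) ≤ ∑ i, (advSet V γ W M).indicator (fun _ => (1 : ℝ)) (S i) := by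
    refine Finset.sum_le_sum fun i _ => ?_
    by_cases hz : S i ∈ advSet V γ W M
    · rw [Set.indicator_of_mem hz]
      exact ramp_le_one _
    · rw [hzero _ (hSr i) hz]
      exact Set.indicator_nonneg (fun _ _ => zero_le_one) _
  rw [Finset.sum_sub_distrib] at hcon'
  simp only [Finset.sum_const, Finset.card_univ, Fintype.card_fin, nsmul_eq_mul] at hcon'
  have h1 := mul_le_mul_of_nonneg_left hpop (Nat.cast_nonneg (α := ℝ) m)
  have h2 : m * ∫ z, f z ∂D - ∑ i, f (S i) ≤ √(32 * m * (K + L)) := hcon'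
  linarith

end Posterior

/-! ### Norm comparison, numerical estimates and balancing of weights -/

section LpNorms

variable {n : ℕ}

lemma vecLpNorm_zero {p : ℝ≥0∞} (hp : 1 ≤ p) : vecLpNorm p (0 : Fin n → ℝ) = 0 := by
  have : Fact (1 ≤ p) := ⟨hp⟩
  simp [vecLpNorm]

lemma continuous_vecLpNorm {p : ℝ≥0∞} (hp : 1 ≤ p) :
    Continuous fun x : Fin n → ℝ => vecLpNorm p x := by
  have : Fact (1 ≤ p) := ⟨hp⟩
  exact (PiLp.continuous_toLp p _).norm

lemma one_le_lpFactor (p : ℝ≥0∞) (n : ℕ) : 1 ≤ lpFactor p n := le_max_left _ _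

lemma vecLpNorm_two_le_of_sum_sq_le {x : Fin n → ℝ} {c : ℝ} (hc : 0 ≤ c)
    (h : ∑ i, x i ^ 2 ≤ c ^ 2) : vecLpNorm 2 x ≤ c := by
  rw [vecLpNorm_two_eq_sqrt]
  refine Real.sqrt_le_iff.2 ⟨hc, le_trans (le_of_eq ?_) h⟩
  simp [dotProduct, pow_two]

lemma vecLpNorm_two_le_lpFactor_mul {p : ℝ≥0∞} (hp : 1 ≤ p) (x : Fin n → ℝ) :
    vecLpNorm 2 x ≤ lpFactor p n * vecLpNorm p x := by
  have hfact : Fact (1 ≤ p) := ⟨hp⟩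
  have hnn : 0 ≤ vecLpNorm p x := norm_nonneg (WithLp.toLp p x)
  have hcoord : ∀ i, |x i| ≤ vecLpNorm p x := fun i => PiLp.norm_apply_le (WithLp.toLp p x) i
  have hf0 : 0 ≤ lpFactor p n := zero_le_one.trans (one_le_lpFactor p n)
  rcases eq_or_ne p ⊤ with rfl | hpt
  · have h1 : √n * vecLpNorm ⊤ x ≤ lpFactor ⊤ n * vecLpNorm ⊤ x := by
      refine mul_le_mul_of_nonneg_right (le_max_of_le_right ?_) hnn
      simp [Real.sqrt_eq_rpow]
    refine le_trans (vecLpNorm_two_le_of_sum_sq_le (by positivity) ?_) h1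
    rw [mul_pow, Real.sq_sqrt (by positivity)]
    refine (Finset.sum_le_sum fun i _ => sq_le_sq.2 ((hcoord i).trans (le_abs_self _))).trans ?_
    simp
  set P := p.toReal with hP
  have hP1 : 1 ≤ P := by
    rw [hP, ← ENNReal.toReal_one]
    exact ENNReal.toReal_mono hpt hp
  have hnorm : vecLpNorm p x = (∑ i, |x i| ^ P) ^ (1 / P) :=
    PiLp.norm_eq_sum (by linarith) (WithLp.toLp p x)
  have hsum0 : 0 ≤ ∑ i, |x i| ^ P := Finset.sum_nonneg fun i _ => by positivity
  rcases le_or_gt P 2 with hP2 | hP2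
  · refine le_trans ?_ (le_mul_of_one_le_left hnn (one_le_lpFactor p n))
    refine vecLpNorm_two_le_of_sum_sq_le hnn ?_
    rcases hnn.eq_or_lt with h0 | h0
    · refine (Finset.sum_nonpos fun i _ => ?_).trans (sq_nonneg _)
      have : x i = 0 := abs_nonpos_iff.1 (by rw [h0]; exact hcoord i)
      simp [this]
    · have hpow : ∑ i, |x i| ^ P = vecLpNorm p x ^ P := by
        rw [hnorm, ← Real.rpow_mul hsum0, one_div, inv_mul_cancel₀ (by linarith), Real.rpow_one]
      calc ∑ i, x i ^ 2 ≤ ∑ i, |x i| ^ P * vecLpNorm p x ^ (2 - P) := by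
            refine Finset.sum_le_sum fun i _ => ?_
            rw [← sq_abs]
            rcases (abs_nonneg (x i)).eq_or_lt with hx | hx
            · rw [← hx]
              have := Real.rpow_nonneg h0.le (2 - P)
              rw [Real.zero_rpow (by linarith)]
              simp
            · have h1 : |x i| ^ 2 = |x i| ^ P * |x i| ^ (2 - P) := by
                rw [← Real.rpow_add hx, add_sub_cancel, Real.rpow_two]
              rw [h1]
              exact mul_le_mul_of_nonneg_left
                (Real.rpow_le_rpow hx.le (hcoord i) (by linarith)) (by positivity)
        _ = vecLpNorm p x ^ 2 := by
            rw [← Finset.sum_mul, hpow, ← Real.rpow_add h0, add_sub_cancel, Real.rpow_two]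
  · have h1 : (n : ℝ) ^ (1 / 2 - 1 / P) * vecLpNorm p x ≤ lpFactor p n * vecLpNorm p x := by
      refine mul_le_mul_of_nonneg_right (le_max_of_le_right (le_of_eq ?_)) hnn
      rw [one_div p, ENNReal.toReal_inv, ← hP, one_div P]
    refine le_trans ?_ h1
    have hmean := Real.rpow_sum_le_const_mul_sum_rpow (Finset.univ : Finset (Fin n))
      (fun i => x i ^ 2) (p := P / 2) (by linarith)
    have h2 : ∀ i, (x i ^ 2) ^ (P / 2) = |x i| ^ P := fun i => by
      rw [← sq_abs, ← Real.rpow_natCast, ← Real.rpow_mul (abs_nonneg _)]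
      congr 1
      push_cast
      ring
    simp only [abs_pow, sq_abs, h2, Finset.card_univ, Fintype.card_fin] at hmean
    have hs2 : 0 ≤ ∑ i, x i ^ 2 := Finset.sum_nonneg fun i _ => sq_nonneg _
    have h3 := Real.rpow_le_rpow (by positivity) hmean (z := 1 / P) (by positivity)
    rw [← Real.rpow_mul hs2, Real.mul_rpow (by positivity) hsum0,
      ← Real.rpow_mul (by positivity), ← hnorm,
      show P / 2 * (1 / P) = 1 / 2 by field_simp,
      show (P / 2 - 1) * (1 / P) = 1 / 2 - 1 / P by field_simp] at h3
    have h4 : x ⬝ᵥ x = ∑ i, x i ^ 2 := by simp [dotProduct, pow_two]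
    rw [vecLpNorm_two_eq_sqrt, Real.sqrt_eq_rpow, h4]
    exact h3

lemma isCompact_vecLpNorm_ball {p : ℝ≥0∞} (hp : 1 ≤ p) (ε : ℝ) :
    IsCompact {v : Fin n → ℝ | vecLpNorm p v ≤ ε} := by
  have hfact : Fact (1 ≤ p) := ⟨hp⟩
  refine Metric.isCompact_of_isClosed_isBounded
    (isClosed_le (continuous_vecLpNorm hp) continuous_const) ?_
  refine (Metric.isBounded_iff_subset_closedBall 0).2 ⟨ε, fun v hv => ?_⟩
  have hv' : vecLpNorm p v ≤ ε := hv
  rw [mem_closedBall_zero_iff,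
    pi_norm_le_iff_of_nonneg ((norm_nonneg (WithLp.toLp p v)).trans hv')]
  exact fun i => (PiLp.norm_apply_le (WithLp.toLp p v) i).trans hv'

end LpNorms

section Numerics

lemma half_le_log {d h : ℕ} (hd : 1 ≤ d) (hh : 2 ≤ h) : (1 : ℝ) / 2 ≤ Real.log (d * h) := by
  have h1 : (2 : ℝ) ≤ d * h := by
    have : 2 ≤ d * h := by nlinarith
    exact_mod_cast this
  have h2 := Real.log_le_log two_pos h1
  have h3 := Real.log_two_gt_d9
  linarith

lemma one_le_mul_log {d h : ℕ} (hd : 1 ≤ d) (hh : 2 ≤ h) : (1 : ℝ) ≤ h * Real.log (d * h) := by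
  have h1 := half_le_log hd hh
  have h2 : (2 : ℝ) ≤ h := by exact_mod_cast hh
  nlinarith

/-- With noise of size `√(60 h log (d h))` the union bound over the nets and the layers leaves a
failure probability of at most `1 / 4`. -/
lemma union_bound_le_quarter {e h : ℕ} (hh : 2 ≤ h) :
    ((e : ℝ) + 2) * (9 * h : ℝ) ^ (2 * h) *
      Real.exp (-(√(60 * (h * Real.log ((e + 1 : ℕ) * h))) ^ 2 / 5)) ≤ 1 / 4 := by
  set Λ := Real.log ((e + 1 : ℕ) * h) with hΛ
  have hh' : (2 : ℝ) ≤ h := by exact_mod_cast hh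
  have he1 : (1 : ℝ) ≤ (e + 1 : ℕ) := by exact_mod_cast Nat.succ_le_succ (Nat.zero_le e)
  have hdh : (2 : ℝ) ≤ (e + 1 : ℕ) * h := by nlinarith
  have hΛ0 : 0 ≤ Λ := Real.log_nonneg (by linarith)
  have hexp : Real.exp Λ = (e + 1 : ℕ) * h := Real.exp_log (by linarith)
  set P : ℝ := (e + 1 : ℕ) * h with hP
  have h16 : (16 : ℝ) ≤ P ^ 4 := by
    have := pow_le_pow_left₀ two_pos.le hdh 4
    linarith
  have h8 : (8 : ℝ) ≤ P ^ 3 := by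
    have := pow_le_pow_left₀ two_pos.le hdh 3
    linarith
  have hhP : (h : ℝ) ≤ P := by rw [hP]; nlinarith
  have hdP : ((e + 1 : ℕ) : ℝ) ≤ P := by rw [hP]; nlinarith
  have h1 : (9 * h : ℝ) ≤ Real.exp (5 * Λ) := by
    have : Real.exp (5 * Λ) = P ^ 5 := by
      rw [← hexp, ← Real.exp_nat_mul]; norm_num
    rw [this]
    nlinarith
  have h2 : 4 * ((e : ℝ) + 2) ≤ Real.exp (4 * Λ) := by
    have h3 : Real.exp (4 * Λ) = P ^ 4 := by
      rw [← hexp, ← Real.exp_nat_mul]; norm_num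
    rw [h3]
    push_cast at hdP
    have he0 : (0 : ℝ) ≤ e := Nat.cast_nonneg e
    nlinarith
  have h3 : (9 * h : ℝ) ^ (2 * h) ≤ Real.exp (10 * (h * Λ)) := by
    refine (pow_le_pow_left₀ (by positivity) h1 (2 * h)).trans (le_of_eq ?_)
    rw [← Real.exp_nat_mul]
    congr 1
    push_cast
    ring
  rw [Real.sq_sqrt (by positivity), show 60 * (h * Λ) / 5 = 12 * (h * Λ) by ring]
  have h4 : Real.exp (4 * Λ) * Real.exp (10 * (h * Λ)) * Real.exp (-(12 * (h * Λ))) ≤ 1 := by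
    rw [← Real.exp_add, ← Real.exp_add, Real.exp_le_one_iff]
    nlinarith
  have h5 : (4 * ((e : ℝ) + 2)) * (9 * h : ℝ) ^ (2 * h) * Real.exp (-(12 * (h * Λ))) ≤
      Real.exp (4 * Λ) * Real.exp (10 * (h * Λ)) * Real.exp (-(12 * (h * Λ))) := by
    gcongr
  linarith

end Numerics

section Rescaling

variable {e : ℕ} {N : Fin (e + 2) → ℕ}

lemma vecLpNorm_two_layer_le (W : Weights N) (x : Fin (N 0) → ℝ) (i : Fin (e + 1)) :
    vecLpNorm 2 (layer W x i.succ) ≤ (∏ j ∈ Finset.Iic i, specNorm (W j)) * vecLpNorm 2 x := by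
  induction i using Fin.induction with
  | zero =>
    rw [show Finset.Iic (0 : Fin (e + 1)) = {0} from by ext j; simp, Finset.prod_singleton]
    exact vecLpNorm_two_mulVec_le (W 0) x
  | succ i ih =>
    have hI : Finset.Iic i.succ = insert i.succ (Finset.Iic i.castSucc) := by
      ext j
      simp only [Finset.mem_Iic, Finset.mem_insert, Fin.le_iff_val_le_val, Fin.ext_iff,
        Fin.val_succ, Fin.val_castSucc]
      omega
    rw [layer_succ, if_neg (by simp), hI,
      Finset.prod_insert (by simp [Fin.le_iff_val_le_val]), mul_assoc]
    exact (vecLpNorm_two_mulVec_le _ _).trans (mul_le_mul_of_nonneg_left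
      ((vecLpNorm_two_relu_le _).trans ih) (specNorm_nonneg _))

lemma vecLpNorm_two_net_le (W : Weights N) (x : Fin (N 0) → ℝ) :
    vecLpNorm 2 (net W x) ≤ (∏ j, specNorm (W j)) * vecLpNorm 2 x := by
  have h := vecLpNorm_two_layer_le W x (Fin.last e)
  rwa [show Finset.Iic (Fin.last e) = Finset.univ from by ext j; simp [Fin.le_last]] at h

/-- By homogeneity the weight matrices can be rescaled to have the same spectral norm without
changing the network function. -/
lemma exists_balanced (W : Weights N) (hW : ∀ i, 0 < specNorm (W i)) :
    ∃ (W' : Weights N) (β : ℝ), 0 < β ∧ β ^ (e + 1) = ∏ i, specNorm (W i) ∧ net W' = net W ∧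
      (∀ i, specNorm (W' i) ≤ β) ∧
      ∑ i, frobNorm (W' i) ^ 2 = β ^ 2 * ∑ i, frobNorm (W i) ^ 2 / specNorm (W i) ^ 2 := by
  have hprod : 0 < ∏ i, specNorm (W i) := Finset.prod_pos fun i _ => hW i
  set β : ℝ := (∏ i, specNorm (W i)) ^ (((e + 1 : ℕ) : ℝ)⁻¹) with hβ
  have hβ0 : 0 < β := Real.rpow_pos_of_pos hprod _
  have hβp : β ^ (e + 1) = ∏ i, specNorm (W i) :=
    Real.rpow_inv_natCast_pow hprod.le (Nat.succ_ne_zero e)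
  refine ⟨fun i => (β / specNorm (W i)) • W i, β, hβ0, hβp, ?_, fun i => ?_, ?_⟩
  · rw [net_smul W _ fun i => (div_pos hβ0 (hW i)).le, Finset.prod_div_distrib]
    simp only [Finset.prod_const, Finset.card_univ, Fintype.card_fin, hβp, div_self hprod.ne',
      one_smul]
  · refine (specNorm_smul_le _ _).trans (le_of_eq ?_)
    rw [abs_of_pos (div_pos hβ0 (hW i)), div_mul_cancel₀ _ (hW i).ne']
  · rw [Finset.mul_sum]
    refine Finset.sum_congr rfl fun i _ => ?_
    rw [frobNorm_smul_sq, div_pow]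
    ring

end Rescaling

/-! ### Union over classes of networks -/

section Assembly

lemma robustLoss_le_one {n k : ℕ} (p : ℝ≥0∞) (ε γ : ℝ) (D : Measure ((Fin n → ℝ) × Fin k))
    [IsProbabilityMeasure D] (f : (Fin n → ℝ) → Fin k → ℝ) : robustLoss p ε γ D f ≤ 1 :=
  measureReal_le_one

lemma empRobustLoss_nonneg {n k m : ℕ} (p : ℝ≥0∞) (ε γ : ℝ) (S : Fin m → (Fin n → ℝ) × Fin k)
    (f : (Fin n → ℝ) → Fin k → ℝ) : 0 ≤ empRobustLoss p ε γ S f :=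
  div_nonneg (Finset.sum_nonneg fun _ _ => Set.indicator_nonneg (fun _ _ => zero_le_one) _)
    (Nat.cast_nonneg m)

/-- If the network function is smaller than half the margin on the data, every sample is an
error. -/
lemma empRobustLoss_eq_one {n k m : ℕ} (hm : 1 ≤ m) {p : ℝ≥0∞} {ε γ : ℝ} (hp : 1 ≤ p)
    (hε : 0 ≤ ε) (S : Fin m → (Fin n → ℝ) × Fin k) (f : (Fin n → ℝ) → Fin k → ℝ)
    (hf : ∀ i, 2 * vecLpNorm 2 (f (S i).1) ≤ γ) : empRobustLoss p ε γ S f = 1 := by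
  have hmem : ∀ i, S i ∈ robustErrorSet p ε γ f := fun i => by
    rw [mem_robustErrorSet_iff]
    refine ⟨0, by rwa [vecLpNorm_zero hp], ?_⟩
    rw [add_zero]
    exact (margin_le _ _).trans (hf i)
  have hm' : (m : ℝ) ≠ 0 := by exact_mod_cast (by omega : m ≠ 0)
  simp [empRobustLoss, Set.indicator_of_mem (hmem _), hm']

/-- The noise level `σ` for networks with `e + 1` layers of spectral norm at most `b`, relative
perturbation `κ` and Gaussian matrices of spectral norm at most `3 * ν`. -/
def noiseLevel (e : ℕ) (κ b ν : ℝ) : ℝ := κ * b / (e + 1) / (6 * ν)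

/-- The squared Frobenius norms of balanced weights, in units of the noise level, are bounded in
terms of the spectral complexity. The bound `b` on the spectral norms may exceed their common value
`β` as long as `b ^ (e + 1)` and `β ^ (e + 1)` agree up to a factor `2`. -/
lemma balanced_sq_le {e : ℕ} {β b G κ ν R γ ρ : ℝ} (hβ : 0 < β) (hβb : β ≤ b)
    (hb2 : b ^ (e + 1) ≤ 2 * β ^ (e + 1)) (hG : 0 ≤ G) (hκ : 0 < κ) (hν : 0 < ν) (hR : 0 < R)
    (hκγ : 16 * κ * R * b ^ (e + 1) = γ) (hν2 : ν ^ 2 = 60 * ρ) :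
    β ^ 2 * G ≤ 2211840 * (R ^ 2 * (e + 1) ^ 2 * ρ * ((β ^ (e + 1)) ^ 2 * G) / γ ^ 2) *
      noiseLevel e κ b ν ^ 2 := by
  have hb : 0 < b := hβ.trans_le hβb
  have hρ : 0 < ρ := by nlinarith [pow_pos hν 2]
  have hρν : ρ = ν ^ 2 / 60 := by linarith
  have key : (b ^ (e + 1)) ^ 2 * β ^ 2 ≤ 4 * b ^ 2 * (β ^ (e + 1)) ^ 2 := by
    have h1 : β ^ 2 ≤ b ^ 2 := pow_le_pow_left₀ hβ.le hβb 2
    have h2 : (b ^ (e + 1)) ^ 2 ≤ (2 * β ^ (e + 1)) ^ 2 := pow_le_pow_left₀ (by positivity) hb2 2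
    calc (b ^ (e + 1)) ^ 2 * β ^ 2 ≤ (2 * β ^ (e + 1)) ^ 2 * b ^ 2 := by gcongr
      _ = _ := by ring
  have hrhs : 2211840 * (R ^ 2 * (e + 1) ^ 2 * ρ * ((β ^ (e + 1)) ^ 2 * G) / γ ^ 2) *
      noiseLevel e κ b ν ^ 2 = 4 * b ^ 2 * (β ^ (e + 1)) ^ 2 * G / (b ^ (e + 1)) ^ 2 := by
    rw [← hκγ, hρν, noiseLevel]
    -- `2211840 = 4 * 16 ^ 2 * 6 ^ 2 * 60`
    field_simp
    ring
  rw [hrhs, le_div_iff₀ (by positivity)]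
  calc β ^ 2 * G * (b ^ (e + 1)) ^ 2 = (b ^ (e + 1)) ^ 2 * β ^ 2 * G := by ring
    _ ≤ _ := by gcongr

variable {e q : ℕ} {N : Fin (e + 2) → ℕ}

/-- The upper bound `(i γ / (2 R))^(1 / (e + 1))` for the balanced spectral norm of the networks in
the `i`-th part of the class. -/
def gridNorm (e : ℕ) (γ R : ℝ) (i : ℕ) : ℝ := (i * γ / (2 * R)) ^ (((e + 1 : ℕ) : ℝ)⁻¹)

lemma gridNorm_nonneg {e : ℕ} {γ R : ℝ} (hγ : 0 ≤ γ) (hR : 0 ≤ R) (i : ℕ) :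
    0 ≤ gridNorm e γ R i := Real.rpow_nonneg (by positivity) _

lemma gridNorm_pow {e : ℕ} {γ R : ℝ} (hγ : 0 ≤ γ) (hR : 0 ≤ R) (i : ℕ) :
    gridNorm e γ R i ^ (e + 1) = i * γ / (2 * R) :=
  Real.rpow_inv_natCast_pow (by positivity) (Nat.succ_ne_zero e)

/-- Unless the generalization bound is trivial, a network can be balanced and then lies in one of
`3 * m ^ 2` classes: the class `(i, j)` bounds the spectral norms in terms of `i` and the squared
Frobenius norms, measured in units of the noise level belonging to `i`, in terms of `j`. -/
lemma exists_grid_class {m : ℕ} (hm : 1 ≤ m) (W : Weights N) {R γ ρ ν X : ℝ} (hR : 0 < R)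
    (hγ : 0 < γ) (hρ : 1 ≤ ρ) (hν : 0 < ν) (hν2 : ν ^ 2 = 60 * ρ)
    (hX : X = R ^ 2 * (e + 1) ^ 2 * ρ * spectralComplexity W / γ ^ 2)
    (hW : γ < 2 * (R * ∏ i, specNorm (W i))) (hXm : X < m) :
    ∃ (W' : Weights N) (i j : ℕ), (1 ≤ i ∧ i ≤ 3 * m) ∧ (1 ≤ j ∧ j ≤ m) ∧ 1 / 4 ≤ X ∧
      (j : ℝ) ≤ 5 * X ∧ net W' = net W ∧ (∀ l, specNorm (W' l) ≤ gridNorm e γ R i) ∧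
      ∑ l, frobNorm (W' l) ^ 2 ≤
        2211840 * j * noiseLevel e (1 / (8 * i)) (gridNorm e γ R i) ν ^ 2 := by
  have hm' : (1 : ℝ) ≤ m := by exact_mod_cast hm
  have hd : (1 : ℝ) ≤ e + 1 := by
    have := Nat.cast_nonneg (α := ℝ) e
    linarith
  set s := ∏ i, specNorm (W i) with hs
  have hs0 : 0 < s := by
    by_contra hneg
    nlinarith
  have hWpos : ∀ i, 0 < specNorm (W i) := fun i => by
    refine lt_of_le_of_ne (specNorm_nonneg _) fun h0 => hs0.ne' ?_
    exact Finset.prod_eq_zero (Finset.mem_univ i) h0.symm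
  obtain ⟨W', β, hβ0, hβp, hnet, hWβ, hfrob⟩ := exists_balanced W hWpos
  rw [← hs] at hβp
  have hΦ : spectralComplexity W =
      s ^ 2 * ∑ i, frobNorm (W i) ^ 2 / specNorm (W i) ^ 2 := by
    rw [spectralComplexity, Finset.prod_pow]
  have hG1 : 1 ≤ ∑ i, frobNorm (W i) ^ 2 / specNorm (W i) ^ 2 := by
    have h1 : (1 : ℝ) ≤ frobNorm (W 0) ^ 2 / specNorm (W 0) ^ 2 := by
      rw [one_le_div (pow_pos (hWpos 0) 2)]
      exact pow_le_pow_left₀ (specNorm_nonneg _) (specNorm_le_frobNorm _) 2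
    exact h1.trans (Finset.single_le_sum
      (f := fun i => frobNorm (W i) ^ 2 / specNorm (W i) ^ 2)
      (fun i _ => div_nonneg (sq_nonneg _) (sq_nonneg _)) (Finset.mem_univ 0))
  rw [hΦ] at hX
  set G := ∑ i, frobNorm (W i) ^ 2 / specNorm (W i) ^ 2
  set a := R * s / γ with ha
  have ha0 : 1 / 2 < a := by
    rw [ha, lt_div_iff₀ hγ]; linarith
  have haX : a ^ 2 ≤ X := by
    have h1 : X = a ^ 2 * ((e + 1) ^ 2 * ρ * G) := by
      rw [hX, ha]; field_simp
    rw [h1]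
    refine le_mul_of_one_le_right (sq_nonneg a) ?_
    exact one_le_mul_of_one_le_of_one_le
      (one_le_mul_of_one_le_of_one_le (one_le_pow₀ hd) hρ) hG1
  have hX4 : 1 / 4 ≤ X := by nlinarith
  -- Both indices are at most of order `m`: since `a ^ 2 ≤ X < m`, the ratio `a` is at most `m`.
  obtain ⟨i, hi⟩ : ∃ i, i = ⌈2 * a⌉₊ := ⟨_, rfl⟩
  obtain ⟨j, hj⟩ : ∃ j, j = ⌈X⌉₊ := ⟨_, rfl⟩
  have hi1 : 1 ≤ i := by rw [hi]; exact Nat.one_le_ceil_iff.2 (by linarith)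
  have hj1 : 1 ≤ j := by rw [hj]; exact Nat.one_le_ceil_iff.2 (by linarith)
  have him : i ≤ 3 * m := by
    rw [hi]
    refine Nat.ceil_le.2 ?_
    have : a ≤ m := by nlinarith
    push_cast
    linarith
  have hjm : j ≤ m := by rw [hj]; exact Nat.ceil_le.2 hXm.le
  have hile : (i : ℝ) ≤ 4 * a := by
    have := Nat.ceil_lt_add_one (show 0 ≤ 2 * a by linarith)
    rw [hi]
    linarith
  have hige : 2 * a ≤ i := by rw [hi]; exact Nat.le_ceil _
  have hjX : X ≤ j := by rw [hj]; exact Nat.le_ceil _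
  have hjX5 : (j : ℝ) ≤ 5 * X := by
    have := Nat.ceil_lt_add_one (show 0 ≤ X by linarith)
    rw [hj]
    linarith
  have hi' : (1 : ℝ) ≤ i := by exact_mod_cast hi1
  have hbp := gridNorm_pow (e := e) hγ.le hR.le i
  have hb0 := gridNorm_nonneg (e := e) hγ.le hR.le i
  set b := gridNorm e γ R i
  have hsa : s = a * γ / R := by rw [ha]; field_simp
  have hβb : β ≤ b := by
    refine le_of_pow_le_pow_left₀ (Nat.succ_ne_zero e) hb0 ?_
    rw [hβp, hbp, hsa, div_le_div_iff₀ hR (by positivity)]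
    have := mul_le_mul_of_nonneg_right hige (mul_pos hγ hR).le
    linarith
  have hb2 : b ^ (e + 1) ≤ 2 * β ^ (e + 1) := by
    rw [hβp, hbp, hsa, ← mul_div_assoc, div_le_div_iff₀ (by positivity) hR]
    have := mul_le_mul_of_nonneg_right hile (mul_pos hγ hR).le
    linarith
  have hdiv := balanced_sq_le (κ := 1 / (8 * i)) (γ := γ) hβ0 hβb hb2 (zero_le_one.trans hG1)
    (by positivity) hν hR (by rw [hbp]; field_simp; norm_num) hν2
  rw [hβp, ← hX] at hdiv
  refine ⟨W', i, j, ⟨hi1, him⟩, ⟨hj1, hjm⟩, hX4, hjX5, hnet, fun l => (hWβ l).trans hβb, ?_⟩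
  rw [hfrob]
  refine hdiv.trans ?_
  gcongr

/-- The generalization bound for an arbitrary threat model that, for each network, amounts to
perturbations from a fixed compact set `V` of at most `h`-dimensional vectors, entering the first
layer through a matrix `M` whose norms are bounded by those of the first weight matrix. -/
theorem measure_not_robust_bound_le {h m : ℕ} (hk : 2 ≤ N (Fin.last (e + 1)))
    (hN : ∀ i : Fin (e + 1), N i.succ ≤ h) (hq : q ≤ h) (hm : 1 ≤ m) {p : ℝ≥0∞} (hp : 1 ≤ p)
    {ε γ δ r s : ℝ} (hε : 0 ≤ ε) (hγ : 0 < γ) (hδ : 0 < δ) (hδ1 : δ < 1) (hr : 0 < r) (hs : 0 ≤ s)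
    (D : Measure ((Fin (N 0) → ℝ) × Fin (N (Fin.last (e + 1))))) [IsProbabilityMeasure D]
    (hD : ∀ᵐ z ∂D, vecLpNorm 2 z.1 ≤ r) {V : Set (Fin q → ℝ)} (hV : IsCompact V)
    (hVs : ∀ v ∈ V, vecLpNorm 2 v ≤ s)
    (hred : ∀ W : Weights N, ∃ M : Matrix (Fin (N (Fin.succ 0))) (Fin q) ℝ,
      specNorm M ≤ specNorm (W 0) ∧ frobNorm M ≤ frobNorm (W 0) ∧
      ∀ γ', robustErrorSet p ε γ' (net W) = advSet V γ' W M) :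
    Measure.pi (fun _ : Fin m => D) {S | ¬ ∀ W : Weights N,
      robustLoss p ε 0 D (net W) - empRobustLoss p ε γ S (net W) ≤
        20000 * √(((r + s) ^ 2 * (e + 1 : ℕ) ^ 2 * h * Real.log ((e + 1 : ℕ) * h) *
          spectralComplexity W / γ ^ 2 + Real.log ((e + 1 : ℕ) * m / δ)) / m)} ≤
      ENNReal.ofReal δ := by
  have hh : 2 ≤ h := hk.trans (hN (Fin.last e))
  have hm' : (1 : ℝ) ≤ m := by exact_mod_cast hm
  have hm0 : (0 : ℝ) < m := by linarith
  have hd : (1 : ℝ) ≤ (e + 1 : ℕ) := by exact_mod_cast Nat.succ_le_succ (Nat.zero_le e)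
  set R := r + s with hR
  have hR0 : 0 < R := by positivity
  set ρ := h * Real.log ((e + 1 : ℕ) * h) with hρ
  have hρ1 : 1 ≤ ρ := one_le_mul_log (Nat.succ_le_succ (Nat.zero_le e)) hh
  set ν := √(60 * ρ) with hν
  have hν2 : ν ^ 2 = 60 * ρ := Real.sq_sqrt (by positivity)
  have hν0 : 0 < ν := Real.sqrt_pos.2 (by positivity)
  have hν1 : 1 ≤ 3 * ν := by nlinarith
  set L := Real.log (3 * m ^ 2 / δ) with hL
  have hL0 : 0 < L := Real.log_pos (by rw [lt_div_iff₀ hδ]; nlinarith)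
  set ℓ := Real.log ((e + 1 : ℕ) * m / δ) with hℓ
  have hℓ0 : 0 ≤ ℓ := Real.log_nonneg (by rw [le_div_iff₀ hδ]; nlinarith)
  have hLℓ : L ≤ 2 + 2 * ℓ := by
    have h1 : L = Real.log 3 + 2 * Real.log m - Real.log δ := by
      rw [hL, Real.log_div (by positivity) hδ.ne', Real.log_mul (by norm_num) (by positivity),
        Real.log_pow]
      norm_num
    have h2 : ℓ = Real.log (e + 1 : ℕ) + Real.log m - Real.log δ := by
      rw [hℓ, Real.log_div (by positivity) hδ.ne', Real.log_mul (by positivity) (by positivity)]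
    have h3 : Real.log 3 ≤ 2 := by
      have := Real.log_le_sub_one_of_pos (show (0 : ℝ) < 3 by norm_num)
      linarith
    have h4 : Real.log δ ≤ 0 := Real.log_nonpos hδ.le hδ1.le
    have h5 : 0 ≤ Real.log ((e + 1 : ℕ) : ℝ) := Real.log_nonneg hd
    linarith
  set bad : ℕ → ℕ → Set (Fin m → (Fin (N 0) → ℝ) × Fin (N (Fin.last (e + 1)))) := fun i j =>
    {S | ¬ ((∀ i, vecLpNorm 2 (S i).1 ≤ r) →
      ∀ (W : Weights N) (M : Matrix (Fin (N (Fin.succ 0))) (Fin q) ℝ),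
        (∀ l, specNorm (W l) ≤ gridNorm e γ R i) → specNorm M ≤ gridNorm e γ R i →
        params W M ⬝ᵥ params W M ≤
          2 * (2211840 * j) * noiseLevel e (1 / (8 * i)) (gridNorm e γ R i) ν ^ 2 →
        m * D.real (advSet V 0 W M) - ∑ i, (advSet V γ W M).indicator (fun _ => (1 : ℝ)) (S i) ≤
          √(32 * m * (2211840 * j + L)))} with hbad
  -- `κ = 1 / (8 i)` is chosen such that `16 κ R b ^ (e + 1) = γ` for `b = gridNorm e γ R i`.
  have hbadm : ∀ i j : ℕ, 1 ≤ i → Measure.pi (fun _ : Fin m => D) (bad i j) ≤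
      ENNReal.ofReal (Real.exp (-L)) := fun i j hi => by
    have hi' : (1 : ℝ) ≤ i := by exact_mod_cast hi
    have hgpow := gridNorm_pow (e := e) hγ.le hR0.le i
    have hg0 : 0 < gridNorm e γ R i := Real.rpow_pos_of_pos (by positivity) _
    have hκ0 : (0 : ℝ) < 1 / (8 * i) := by positivity
    refine measure_deviation_fixed_scale_le (κ := 1 / (8 * i)) (by omega) hN hq hm D hV hVs hg0.le ?_
      hν0.le hν1 hκ0.le ?_ hr hs (union_bound_le_quarter hh) ?_ ?_ hγ (by positivity) hD
    · unfold noiseLevel; positivity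
    · rw [div_le_one (by positivity)]
      linarith
    · unfold noiseLevel; field_simp; ring
    · rw [hgpow, ← hR]
      refine le_of_eq ?_
      field_simp
      norm_num
  have hnull : Measure.pi (fun _ : Fin m => D) {S | ¬ ∀ i, vecLpNorm 2 (S i).1 ≤ r} = 0 := by
    have : ∀ᵐ S ∂(Measure.pi fun _ : Fin m => D), ∀ i, vecLpNorm 2 (S i).1 ≤ r :=
      ae_all_iff.2 fun i =>
        (measurePreserving_eval (fun _ : Fin m => D) i).quasiMeasurePreserving.ae hD
    exact ae_iff.1 this
  have hsub : {S | ¬ ∀ W : Weights N,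
      robustLoss p ε 0 D (net W) - empRobustLoss p ε γ S (net W) ≤
        20000 * √((R ^ 2 * (e + 1 : ℕ) ^ 2 * h * Real.log ((e + 1 : ℕ) * h) *
          spectralComplexity W / γ ^ 2 + ℓ) / m)} ⊆
      {S | ¬ ∀ i, vecLpNorm 2 (S i).1 ≤ r} ∪
        ⋃ x ∈ Finset.Icc 1 (3 * m) ×ˢ Finset.Icc 1 m, bad x.1 x.2 := by
    intro S hS
    by_contra hcon
    refine hS fun W => ?_
    simp only [Set.mem_union, Set.mem_ofPred_eq, not_or, not_not, Set.mem_iUnion, not_exists,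
      Finset.mem_product, Finset.mem_Icc, Prod.forall] at hcon
    obtain ⟨hSr, hgood⟩ := hcon
    have hloss1 := robustLoss_le_one p ε 0 D (net W)
    have hemp0 := empRobustLoss_nonneg p ε γ S (net W)
    rcases le_or_gt (2 * (R * ∏ i, specNorm (W i))) γ with htriv | hnontriv
    · -- the network is so small that the empirical margin loss equals one
      rw [empRobustLoss_eq_one hm hp hε S (net W) fun i => ?_]
      · exact (sub_nonpos.2 hloss1).trans (by positivity)
      · refine le_trans ?_ htriv
        have h1 := vecLpNorm_two_net_le W (S i).1
        have h2 : 0 ≤ ∏ j, specNorm (W j) := Finset.prod_nonneg fun j _ => specNorm_nonneg _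
        have h3 : vecLpNorm 2 (S i).1 ≤ R := (hSr i).trans (by linarith)
        nlinarith
    set X := R ^ 2 * (e + 1 : ℕ) ^ 2 * h * Real.log ((e + 1 : ℕ) * h) *
        spectralComplexity W / γ ^ 2 with hX
    rcases le_or_gt (m : ℝ) X with hbig | hsmall
    · -- the right-hand side is at least one
      have h1 : 1 ≤ √((X + ℓ) / m) := by
        rw [Real.one_le_sqrt, one_le_div hm0]
        linarith
      linarith
    obtain ⟨W', i, j, hi, hj, hX4, hj5, hnet, hW', hfrob⟩ := exists_grid_class hm W hR0 hγ hρ1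
      hν0 hν2 (by rw [hX, hρ]; push_cast; ring) hnontriv hsmall
    obtain ⟨M, hM1, hM2, hM3⟩ := hred W'
    have hparams : params W' M ⬝ᵥ params W' M ≤
        2 * (2211840 * j) * noiseLevel e (1 / (8 * i)) (gridNorm e γ R i) ν ^ 2 := by
      rw [dotProduct_self_eq_frobNorm, sideOf_params, weightsOf_params]
      have h1 : frobNorm M ^ 2 ≤ ∑ i, frobNorm (W' i) ^ 2 :=
        (pow_le_pow_left₀ (frobNorm_nonneg _) hM2 2).trans
          (Finset.single_le_sum (f := fun i => frobNorm (W' i) ^ 2)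
            (fun i _ => sq_nonneg _) (Finset.mem_univ 0))
      linarith
    have hmain : m * D.real (advSet V 0 W' M) -
        ∑ i, (advSet V γ W' M).indicator (fun _ => (1 : ℝ)) (S i) ≤
          √(32 * m * (2211840 * j + L)) := by
      have h1 := hgood i j ⟨hi, hj⟩
      simp only [hbad, Set.mem_ofPred_eq, not_not] at h1
      exact h1 hSr W' M hW' (hM1.trans (hW' 0)) hparams
    have hloss : robustLoss p ε 0 D (net W) - empRobustLoss p ε γ S (net W) =
        (m * D.real (advSet V 0 W' M) -
          ∑ i, (advSet V γ W' M).indicator (fun _ => (1 : ℝ)) (S i)) / m := by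
      rw [robustLoss, empRobustLoss, ← hnet, hM3, hM3]
      field_simp
    rw [hloss, div_le_iff₀ hm0]
    refine hmain.trans ?_
    rw [show (20000 : ℝ) * √((X + ℓ) / m) * m = √((20000 * m) ^ 2 * ((X + ℓ) / m)) by
      rw [Real.sqrt_mul (by positivity), Real.sqrt_sq (by positivity)]; ring]
    refine Real.sqrt_le_sqrt ?_
    rw [show (20000 * (m : ℝ)) ^ 2 * ((X + ℓ) / m) = m * (400000000 * (X + ℓ)) by
      field_simp; ring]
    rw [show 32 * (m : ℝ) * (2211840 * j + L) = m * (32 * (2211840 * j + L)) by ring]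
    refine mul_le_mul_of_nonneg_left ?_ hm0.le
    -- uses `j ≤ 5 X` and `L ≤ 2 + 2 ℓ ≤ 8 X + 2 ℓ`
    linarith
  refine (measure_mono hsub).trans ((measure_union_le _ _).trans ?_)
  rw [hnull, zero_add]
  refine (measure_biUnion_finset_le _ _).trans ?_
  refine (Finset.sum_le_card_nsmul _ _ (ENNReal.ofReal (Real.exp (-L))) fun x hx => ?_).trans ?_
  · rw [Finset.mem_product, Finset.mem_Icc] at hx
    exact hbadm x.1 x.2 hx.1.1
  · rw [Finset.card_product, Nat.card_Icc, Nat.card_Icc, nsmul_eq_mul,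
      ← ENNReal.ofReal_natCast, ← ENNReal.ofReal_mul (by positivity)]
    refine ENNReal.ofReal_le_ofReal (le_of_eq ?_)
    rw [hL, ← Real.log_inv, Real.exp_log (by positivity)]
    push_cast [Nat.add_sub_cancel]
    field_simp

end Assembly

end RobustNet

end

theorem theorem1 :
    ∃ C : ℝ, 0 < C ∧
      ∀ (d : ℕ) (N : Fin (d + 1) → ℕ) (h m : ℕ) (B ε γ δ : ℝ)
        (D : Measure ((Fin (N 0) → ℝ) × Fin (N (Fin.last d)))) [IsProbabilityMeasure D],
        1 ≤ d → 2 ≤ N (Fin.last d) → (∀ i : Fin d, N i.succ ≤ h) → 1 ≤ m →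
        0 < B → 0 < ε → 0 < γ → 0 < δ →
        -- Euclidean inputs and Euclidean attacks
        ((∀ᵐ z ∂D, RobustNet.vecLpNorm 2 z.1 ≤ B) →
          Measure.pi (fun _ : Fin m => D)
            {S | ¬ ∀ W : RobustNet.Weights N,
              RobustNet.robustLoss 2 ε 0 D (RobustNet.net W)
                  - RobustNet.empRobustLoss 2 ε γ S (RobustNet.net W) ≤
                C * √(((B + ε) ^ 2 * d ^ 2 * h * Real.log (d * h)
                      * RobustNet.spectralComplexity W / γ ^ 2
                    + Real.log (d * m / δ)) / m)} ≤ ENNReal.ofReal δ) ∧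
        -- `ℓ_p` inputs and `ℓ_p` attacks
        (∀ p : ℝ≥0∞, 1 ≤ p → N 0 ≤ h → (∀ᵐ z ∂D, RobustNet.vecLpNorm p z.1 ≤ B) →
          Measure.pi (fun _ : Fin m => D)
            {S | ¬ ∀ W : RobustNet.Weights N,
              RobustNet.robustLoss p ε 0 D (RobustNet.net W)
                  - RobustNet.empRobustLoss p ε γ S (RobustNet.net W) ≤
                C * √(((RobustNet.lpFactor p (N 0) * (B + ε)) ^ 2 * d ^ 2 * h * Real.log (d * h)
                      * RobustNet.spectralComplexity W / γ ^ 2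
                    + Real.log (d * m / δ)) / m)} ≤ ENNReal.ofReal δ) := by
  refine ⟨20000, by norm_num, ?_⟩
  -- The case `δ ≥ 1`, where the logarithm may be negative, is trivial.
  intro d N h m B ε γ δ D _ hd hk hN hm hB hε hγ hδ
  rcases le_or_gt 1 δ with hδ1 | hδ1
  · have htriv : ∀ A : Set (Fin m → (Fin (N 0) → ℝ) × Fin (N (Fin.last d))),
        Measure.pi (fun _ : Fin m => D) A ≤ ENNReal.ofReal δ := fun A =>
      prob_le_one.trans (by rwa [ENNReal.one_le_ofReal])
    exact ⟨fun _ => htriv _, fun _ _ _ _ => htriv _⟩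
  obtain ⟨e, rfl⟩ : ∃ e, d = e + 1 := ⟨d - 1, by omega⟩
  refine ⟨fun hD => ?_, fun p hp hN0 hD => ?_⟩
  · refine RobustNet.measure_not_robust_bound_le hk hN le_rfl hm (by norm_num) hε.le hγ hδ hδ1
      hB hε.le D hD (RobustNet.isCompact_vecLpNorm_ball (n := h) (p := 2) (by norm_num) ε)
      (fun v hv => hv) fun W => ?_
    -- The input dimension is not bounded by `h`, but the row space of `W 0` has dimension at most
    -- `h`, and only the projection of an attack to it matters.
    obtain ⟨M, hM1, hM2, hM3, hM4⟩ := RobustNet.exists_matrix_image_ball_eq (hN 0) (W 0)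
    refine ⟨M, hM1, hM2, fun γ' => ?_⟩
    ext z
    rw [RobustNet.mem_robustErrorSet_iff]
    constructor
    · rintro ⟨x', hx', hmar⟩
      obtain ⟨v, hv, hvx⟩ := hM3 x'
      refine ⟨v, hv.trans hx', ?_⟩
      rwa [← RobustNet.net_add_eq_augNet W M z.1 x' v hvx]
    · rintro ⟨v, hv, hmar⟩
      obtain ⟨x', hx', hvx⟩ := hM4 v
      refine ⟨x', le_trans hx' hv, ?_⟩
      rwa [RobustNet.net_add_eq_augNet W M z.1 x' v hvx.symm]
  · have hf0 : 0 < RobustNet.lpFactor p (N 0) :=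
      zero_lt_one.trans_le (RobustNet.one_le_lpFactor p (N 0))
    have hl2 : ∀ (c : ℝ) (x : Fin (N 0) → ℝ), RobustNet.vecLpNorm p x ≤ c →
        RobustNet.vecLpNorm 2 x ≤ RobustNet.lpFactor p (N 0) * c := fun c x hx =>
      (RobustNet.vecLpNorm_two_le_lpFactor_mul hp x).trans (mul_le_mul_of_nonneg_left hx hf0.le)
    rw [mul_add]
    refine RobustNet.measure_not_robust_bound_le hk hN hN0 hm hp hε.le hγ hδ hδ1
      (mul_pos hf0 hB) (mul_pos hf0 hε).le D (hD.mono fun z hz => hl2 B z.1 hz)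
      (RobustNet.isCompact_vecLpNorm_ball hp ε) (fun v hv => hl2 ε v hv) fun W => ?_
    refine ⟨W 0, le_rfl, le_rfl, fun γ' => ?_⟩
    ext z
    rw [RobustNet.mem_robustErrorSet_iff]
    constructor
    · rintro ⟨x', hx', hmar⟩
      have h := RobustNet.net_add_eq_augNet W (W 0) z.1 x' x' rfl
      exact ⟨x', hx', (congrArg (RobustNet.margin · z.2) h).ge.trans hmar⟩
    · rintro ⟨v, hv, hmar⟩
      have h := RobustNet.net_add_eq_augNet W (W 0) z.1 v v rfl
      exact ⟨v, hv, (congrArg (RobustNet.margin · z.2) h).le.trans hmar⟩
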